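/- An instance of the problem consists of a finite set $\mathcal{D}$ of convex polygons (each given by the list of its vertices in counterclockwise order), a finite set $P$ of points in the plane, all coordinates being integers, and a positive integer $k$; the question is whether there are $k$ polygons in $\mathcal{D}$ that together cover $P$. Running times are measured on a random access machine with logarithmic cost. The Strong Exponential Time Hypothesis (SETH) states that for no $\epsilon>0$ there is an algorithm that decides the satisfiability of CNF formulas $\varphi$ with $n$ variables in time $(2-\epsilon)^n\cdot|\varphi|^{O(1)}$. Assume SETH. Then there is no algorithm that decides this problem in time $f(k)\cdot(|\mathcal{D}|+|P|)^{k-\epsilon}$ for any computable function $f$ and any $\epsilon>0$. Moreover, for every fixed integer $k\ge 3$ and every $\epsilon>0$, no algorithm decides the problem for this $k$ in time $O\big((|\mathcal{D}|+|P|)^{k-\epsilon}\big)$, not even if it is required to be correct and fast only on the instances with $|\mathcal{D}|+|P|\ge 1$ in which every polygon has at most $|\mathcal{D}|+|P|$ vertices and all coordinates are at most $(|\mathcal{D}|+|P|)^2$ in absolute value. -/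

import Mathlib

/-! ### Machine model: a random access machine with logarithmic cost

A machine has finitely many integer arrays (the ones its program mentions), each with random access,
and a structured program. Every arithmetic operation and every memory access is charged
the bit lengths of all numbers that occur in it, including addresses and results. -/

namespace RAM

/-- The memory: `s x i` is the content of cell `i` of array `x`. -/
abbrev Store := ℕ → ℤ → ℤ

/-- Arithmetic expressions; `get x i` reads cell `i` of array `x`. -/
inductive Expr where
  | const (c : ℤ)
  | get (x : ℕ) (i : Expr)
  | add (a b : Expr)
  | sub (a b : Expr)
  | mul (a b : Expr)
  | div (a b : Expr)

/-- The value of an expression (`div` is integer division). -/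
def Expr.eval (s : Store) : Expr → ℤ
  | .const c => c
  | .get x i => s x (i.eval s)
  | .add a b => a.eval s + b.eval s
  | .sub a b => a.eval s - b.eval s
  | .mul a b => a.eval s * b.eval s
  | .div a b => a.eval s / b.eval s

/-- The cost of handling one integer: one plus its bit length. -/
def intCost (z : ℤ) : ℕ := z.natAbs.size + 1

/-- The logarithmic cost of evaluating an expression: every intermediate value is charged. -/
def Expr.cost (s : Store) : Expr → ℕ
  | .const c => intCost c
  | .get x i => i.cost s + intCost ((Expr.get x i).eval s)
  | .add a b => a.cost s + b.cost s + intCost ((Expr.add a b).eval s)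
  | .sub a b => a.cost s + b.cost s + intCost ((Expr.sub a b).eval s)
  | .mul a b => a.cost s + b.cost s + intCost ((Expr.mul a b).eval s)
  | .div a b => a.cost s + b.cost s + intCost ((Expr.div a b).eval s)

/-- Programs. `assign x i e` writes the value of `e` to cell `i` of array `x`; the tests of `ite`
and `loop` succeed when the value of the expression is positive. -/
inductive Prog where
  | skip
  | assign (x : ℕ) (i e : Expr)
  | seq (p q : Prog)
  | ite (e : Expr) (p q : Prog)
  | loop (e : Expr) (p : Prog)

/-- `Exec p s t s'`: started on memory `s`, the program `p` halts with memory `s'` and total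
cost `t`. -/
inductive Exec : Prog → Store → ℕ → Store → Prop where
  | skip (s : Store) : Exec .skip s 1 s
  | assign (x : ℕ) (i e : Expr) (s : Store) :
      Exec (.assign x i e) s (i.cost s + e.cost s + 1)
        (Function.update s x (Function.update (s x) (i.eval s) (e.eval s)))
  | seq {p q : Prog} {s s' s'' : Store} {t u : ℕ} :
      Exec p s t s' → Exec q s' u s'' → Exec (.seq p q) s (t + u) s''
  | iteTrue {e : Expr} {p q : Prog} {s s' : Store} {t : ℕ} :
      0 < e.eval s → Exec p s t s' → Exec (.ite e p q) s (e.cost s + 1 + t) s'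
  | iteFalse {e : Expr} {p q : Prog} {s s' : Store} {t : ℕ} :
      ¬ 0 < e.eval s → Exec q s t s' → Exec (.ite e p q) s (e.cost s + 1 + t) s'
  | loopDone {e : Expr} {p : Prog} {s : Store} :
      ¬ 0 < e.eval s → Exec (.loop e p) s (e.cost s + 1) s
  | loopStep {e : Expr} {p : Prog} {s s' s'' : Store} {t u : ℕ} :
      0 < e.eval s → Exec p s t s' → Exec (.loop e p) s' u s'' →
      Exec (.loop e p) s (e.cost s + 1 + t + u) s''

/-- The initial memory on input `w`: the input is in cells `0, 1, …` of array `0`, every other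
cell holds `0`. -/
def start (w : List ℤ) : Store := fun x i =>
  if x = 0 ∧ 0 ≤ i then w.getD i.toNat 0 else 0

/-- On input `w` the program halts within cost `T`, and it accepts (leaves a nonzero number in
cell `0` of array `1`) exactly if `answer` holds. -/
def DecidesWithin (p : Prog) (w : List ℤ) (answer : Prop) (T : ℝ) : Prop :=
  ∃ (t : ℕ) (s : Store), Exec p (start w) t s ∧ (t : ℝ) ≤ T ∧ (s 1 0 ≠ 0 ↔ answer)

end RAM

/-! ### CNF satisfiability and the Strong Exponential Time Hypothesis -/

/-- A formula in conjunctive normal form: a list of clauses, which are lists of literals; the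
literal `(v, b)` is true when the variable `v` has the value `b`. -/
structure CNF where
  numVars : ℕ
  clauses : List (List (Fin numVars × Bool))

namespace CNF

def Satisfiable (φ : CNF) : Prop :=
  ∃ a : Fin φ.numVars → Bool, ∀ c ∈ φ.clauses, ∃ l ∈ c, a l.1 = l.2

/-- Number of variables plus number of clauses plus number of literal occurrences. -/
def size (φ : CNF) : ℕ :=
  φ.numVars + (φ.clauses.map fun c => c.length + 1).sum

/-- The literals of variable number `v` are written as `v + 1` and `-(v + 1)`. -/
def encodeLiteral {n : ℕ} (l : Fin n × Bool) : ℤ :=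
  if l.2 then ((l.1 : ℕ) : ℤ) + 1 else -(((l.1 : ℕ) : ℤ) + 1)

/-- The number of variables, the number of clauses, and the clauses, each preceded by its length. -/
def encode (φ : CNF) : List ℤ :=
  (φ.numVars : ℤ) :: (φ.clauses.length : ℤ) ::
    φ.clauses.flatMap fun c => (c.length : ℤ) :: c.map encodeLiteral

end CNF

/-- SETH: for no `ε > 0` can the satisfiability of CNF formulas with `n` variables be decided in
time `(2 - ε)^n`, up to a factor polynomial in the size of the formula. -/
def SETH : Prop :=
  ∀ ε : ℝ, 0 < ε → ε < 1 → ¬ ∃ (A : RAM.Prog) (C : ℝ) (c : ℕ), ∀ φ : CNF,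
    RAM.DecidesWithin A φ.encode φ.Satisfiable
      (C * (2 - ε) ^ φ.numVars * ((φ.size : ℝ) + 1) ^ c)

/-! ### Covering points with convex polygons -/

/-- Twice the signed area of the triangle `a b c`; it is positive for a left turn. -/
def orient (a b c : ℤ × ℤ) : ℤ :=
  (b.1 - a.1) * (c.2 - a.2) - (b.2 - a.2) * (c.1 - a.1)

/-- `v` lists the vertices of a (nondegenerate) convex polygon in counterclockwise order, from an
arbitrary first vertex on. -/
def IsConvexPolygon (v : List (ℤ × ℤ)) : Prop :=
  3 ≤ v.length ∧
    ∀ i j l : Fin v.length, i < j → j < l → 0 < orient (v.get i) (v.get j) (v.get l)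

/-- A point with integer coordinates as a point of the real plane. -/
def toPlane (q : ℤ × ℤ) : ℝ × ℝ := ((q.1 : ℝ), (q.2 : ℝ))

/-- The region of the plane bounded by the convex polygon with vertices `v`, boundary included. -/
def region (v : List (ℤ × ℤ)) : Set (ℝ × ℝ) :=
  convexHull ℝ {p | ∃ q ∈ v, p = toPlane q}

/-- A finite set of convex polygons and a finite set of points in the plane, each in an arbitrary
order. -/
structure CoverInstance where
  polygons : List (List (ℤ × ℤ))
  points : List (ℤ × ℤ)
  convex : ∀ v ∈ polygons, IsConvexPolygon v
  polygons_distinct : polygons.Pairwise fun v w => region v ≠ region w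
  points_distinct : points.Nodup

namespace CoverInstance

/-- The number of polygons plus the number of points. -/
def card (I : CoverInstance) : ℕ := I.polygons.length + I.points.length

/-- There are `k` polygons that together cover all the points. -/
def HasCover (I : CoverInstance) (k : ℕ) : Prop :=
  ∃ S : Finset (Fin I.polygons.length), S.card = k ∧
    ∀ p ∈ I.points, ∃ i ∈ S, toPlane p ∈ region (I.polygons.get i)

/-- Every polygon has at most `n` vertices and all coordinates are at most `n ^ 2` in absolute
value, where `n` is the number of polygons and points. -/
def Compact (I : CoverInstance) : Prop :=
  (∀ v ∈ I.polygons, v.length ≤ I.card ∧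
    ∀ q ∈ v, |q.1| ≤ (I.card : ℤ) ^ 2 ∧ |q.2| ≤ (I.card : ℤ) ^ 2) ∧
  ∀ q ∈ I.points, |q.1| ≤ (I.card : ℤ) ^ 2 ∧ |q.2| ≤ (I.card : ℤ) ^ 2

/-- A list of points: its length, followed by the coordinates. -/
def encodePoints (v : List (ℤ × ℤ)) : List ℤ :=
  (v.length : ℤ) :: v.flatMap fun q => [q.1, q.2]

/-- The input for the question whether `k` polygons suffice: `k`, the number of polygons, the
polygons, and the points. -/
def encode (I : CoverInstance) (k : ℕ) : List ℤ :=
  (k : ℤ) :: (I.polygons.length : ℤ) :: I.polygons.flatMap encodePoints ++ encodePoints I.points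

end CoverInstance

/-! The proof reduces satisfiability to covering. Split the `n` variables into `k` groups of about
`n / k` variables. Each pair of a group and an assignment to it becomes a polygon, each clause and
each group becomes a point. A polygon is to contain the point of its own group and the points of the
clauses that its partial assignment satisfies.

Such incidences are realised on the parabola `y = x ^ 2`: increasing abscissae always give a convex
polygon, and a point of the parabola lies in it only as a vertex (`toPlane_onParabola_mem_region`).
Covering the `k` group points with `k` polygons forces exactly one polygon per group, that is, a
total assignment; the clause points then say that it satisfies the formula (`CNF.hasCover_toCover`).

Up to a constant depending on `k` and a factor linear in the size of the formula, the instance has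
`2 ^ (n / k)` members. Time `card ^ (k - δ)` thus becomes `(2 ^ ((k - δ) / k)) ^ n` times a
polynomial, with a base below `2`, against SETH (`not_decides_compact_of_SETH`). The bound with
`f(k)` is refuted by its case `k = 3`.

SETH speaks of programs, so the reduction is a program too. The rules for `Runs` bound its cost by
the bit length, the loop lengths and a constant (`CNF.runs_translate`). The assumed covering
algorithm is run after it on renamed arrays (`Exec.rename`, `CNF.decidesWithin_translate`). -/

namespace RAM

/-! ### Renaming arrays -/

/-- The assumed covering algorithm expects a fresh memory. After the translation has used its
registers, renaming moves the algorithm to arrays that look fresh. -/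
def Expr.rename (ρ : ℕ → ℕ) : Expr → Expr
  | .const a => .const a
  | .get x i => .get (ρ x) (i.rename ρ)
  | .add a b => .add (a.rename ρ) (b.rename ρ)
  | .sub a b => .sub (a.rename ρ) (b.rename ρ)
  | .mul a b => .mul (a.rename ρ) (b.rename ρ)
  | .div a b => .div (a.rename ρ) (b.rename ρ)

def Prog.rename (ρ : ℕ → ℕ) : Prog → Prog
  | .skip => .skip
  | .assign x i e => .assign (ρ x) (i.rename ρ) (e.rename ρ)
  | .seq p q => .seq (p.rename ρ) (q.rename ρ)
  | .ite e p q => .ite (e.rename ρ) (p.rename ρ) (q.rename ρ)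
  | .loop e p => .loop (e.rename ρ) (p.rename ρ)

theorem Expr.eval_rename {ρ : ℕ → ℕ} {r s : Store} (h : ∀ x, r (ρ x) = s x) (e : Expr) :
    (e.rename ρ).eval r = e.eval s := by
  induction e with
  | const a => rfl
  | get x i ih => simp [Expr.rename, Expr.eval, ih, h]
  | add a b iha ihb => simp [Expr.rename, Expr.eval, iha, ihb]
  | sub a b iha ihb => simp [Expr.rename, Expr.eval, iha, ihb]
  | mul a b iha ihb => simp [Expr.rename, Expr.eval, iha, ihb]
  | div a b iha ihb => simp [Expr.rename, Expr.eval, iha, ihb]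

theorem Expr.cost_rename {ρ : ℕ → ℕ} {r s : Store} (h : ∀ x, r (ρ x) = s x) (e : Expr) :
    (e.rename ρ).cost r = e.cost s := by
  induction e with
  | const a => rfl
  | get x i ih => simp [Expr.rename, Expr.cost, Expr.eval, ih, h, Expr.eval_rename h]
  | add a b iha ihb => simp [Expr.rename, Expr.cost, Expr.eval, iha, ihb, Expr.eval_rename h]
  | sub a b iha ihb => simp [Expr.rename, Expr.cost, Expr.eval, iha, ihb, Expr.eval_rename h]
  | mul a b iha ihb => simp [Expr.rename, Expr.cost, Expr.eval, iha, ihb, Expr.eval_rename h]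
  | div a b iha ihb => simp [Expr.rename, Expr.cost, Expr.eval, iha, ihb, Expr.eval_rename h]

/-- A program whose arrays are renamed behaves, at the same cost, like the original one. -/
theorem Exec.rename {ρ : ℕ → ℕ} (hρ : ρ.Injective) {p : Prog} {s s' : Store} {t : ℕ}
    (hp : Exec p s t s') : ∀ r : Store, (∀ x, r (ρ x) = s x) →
      ∃ r', Exec (p.rename ρ) r t r' ∧ ∀ x, r' (ρ x) = s' x := by
  induction hp with
  | skip s => exact fun r h => ⟨r, .skip r, h⟩
  | assign x i e s =>
    intro r h
    rw [← Expr.cost_rename h, ← Expr.cost_rename h]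
    refine ⟨_, .assign (ρ x) (i.rename ρ) (e.rename ρ) r, fun y => ?_⟩
    by_cases hy : y = x
    · subst hy
      simp [Expr.eval_rename h, h]
    · simp [hρ.ne hy, h, hy]
  | seq _ _ ih₁ ih₂ =>
    intro r h
    obtain ⟨r₁, h₁, e₁⟩ := ih₁ r h
    obtain ⟨r₂, h₂, e₂⟩ := ih₂ r₁ e₁
    exact ⟨r₂, .seq h₁ h₂, e₂⟩
  | iteTrue hc _ ih =>
    intro r h
    obtain ⟨r₁, h₁, e₁⟩ := ih r h
    rw [← Expr.eval_rename h] at hc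
    rw [← Expr.cost_rename h]
    exact ⟨r₁, .iteTrue hc h₁, e₁⟩
  | iteFalse hc _ ih =>
    intro r h
    obtain ⟨r₁, h₁, e₁⟩ := ih r h
    rw [← Expr.eval_rename h] at hc
    rw [← Expr.cost_rename h]
    exact ⟨r₁, .iteFalse hc h₁, e₁⟩
  | loopDone hc =>
    intro r h
    rw [← Expr.eval_rename h] at hc
    rw [← Expr.cost_rename h]
    exact ⟨r, .loopDone hc, h⟩
  | loopStep hc _ _ ih₁ ih₂ =>
    intro r h
    obtain ⟨r₁, h₁, e₁⟩ := ih₁ r h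
    obtain ⟨r₂, h₂, e₂⟩ := ih₂ r₁ e₁
    rw [← Expr.eval_rename h] at hc
    rw [← Expr.cost_rename h]
    exact ⟨r₂, .loopStep hc h₁ h₂, e₂⟩

/-! ### Costs on bounded memories -/

/-- All numbers in the memory are at most `2 ^ b` in absolute value. -/
def Bounded (b : ℕ) (s : Store) : Prop := ∀ x i, |s x i| ≤ 2 ^ b

/-- On a memory bounded by `2 ^ b`, the value of `e` is at most `2 ^ (b * e.deg)`. -/
def Expr.deg : Expr → ℕ
  -- The degree must serve for all `b ≥ 1` at once; `|c| < 2 ^ |c|` allows this, and the `1` keeps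
  -- degrees positive.
  | .const c => c.natAbs + 1
  | .get _ _ => 1
  | .add a b => a.deg + b.deg
  | .sub a b => a.deg + b.deg
  | .mul a b => a.deg + b.deg
  | .div a b => a.deg + b.deg

/-- On a memory bounded by `2 ^ b`, the evaluation of `e` costs at most `b * e.weight`. -/
def Expr.weight : Expr → ℕ
  | .const c => (Expr.const c).deg + 2
  | .get _ i => i.weight + 3
  | .add a b => a.weight + b.weight + (a.deg + b.deg + 2)
  | .sub a b => a.weight + b.weight + (a.deg + b.deg + 2)
  | .mul a b => a.weight + b.weight + (a.deg + b.deg + 2)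
  | .div a b => a.weight + b.weight + (a.deg + b.deg + 2)

theorem Expr.one_le_deg (e : Expr) : 1 ≤ e.deg := by
  induction e <;> simp only [Expr.deg] <;> omega

theorem intCost_le {z : ℤ} {b d : ℕ} (hb : 1 ≤ b) (h : |z| ≤ 2 ^ (b * d)) :
    intCost z ≤ b * (d + 2) := by
  have h1 : z.natAbs < 2 ^ (b * d + 1) := by
    have : (z.natAbs : ℤ) ≤ 2 ^ (b * d) := by rwa [Int.natCast_natAbs]
    have : z.natAbs ≤ 2 ^ (b * d) := by exact_mod_cast this
    have h2 : 0 < 2 ^ (b * d) := by positivity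
    rw [pow_succ]
    omega
  have h2 := Nat.size_le.2 h1
  unfold intCost
  nlinarith

/-- Two numbers that are at least `2` have a sum no larger than their product. Hence degrees add up
for sums just as for products. -/
theorem add_pow_two_le {b c d : ℕ} (hb : 1 ≤ b) (hc : 1 ≤ c) (hd : 1 ≤ d) :
    (2 : ℤ) ^ (b * c) + 2 ^ (b * d) ≤ 2 ^ (b * (c + d)) := by
  have h : ∀ c, 1 ≤ c → (2 : ℤ) ≤ 2 ^ (b * c) := fun c hc => by
    calc (2 : ℤ) = 2 ^ 1 := by norm_num
      _ ≤ 2 ^ (b * c) := pow_le_pow_right₀ (by norm_num) (Nat.mul_pos hb hc)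
  rw [mul_add, pow_add]
  nlinarith [h c hc, h d hd]

theorem Expr.abs_eval_le {b : ℕ} {s : Store} (hb : 1 ≤ b) (hs : Bounded b s) (e : Expr) :
    |e.eval s| ≤ 2 ^ (b * e.deg) := by
  induction e with
  | const c =>
    simp only [Expr.eval, Expr.deg]
    have h1 : c.natAbs < 2 ^ c.natAbs := Nat.lt_two_pow_self
    have h2 : 2 ^ c.natAbs ≤ 2 ^ (b * (c.natAbs + 1)) :=
      Nat.pow_le_pow_right (by norm_num) (by nlinarith [c.natAbs.zero_le])
    rw [← Int.natCast_natAbs]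
    exact_mod_cast h1.le.trans h2
  | get x i _ => simpa [Expr.eval, Expr.deg] using hs x (i.eval s)
  | add a c iha ihc =>
    simp only [Expr.eval, Expr.deg]
    have := add_pow_two_le hb a.one_le_deg c.one_le_deg
    linarith [abs_add_le (a.eval s) (c.eval s)]
  | sub a c iha ihc =>
    simp only [Expr.eval, Expr.deg]
    have := add_pow_two_le hb a.one_le_deg c.one_le_deg
    linarith [abs_sub (a.eval s) (c.eval s)]
  | mul a c iha ihc =>
    simp only [Expr.eval, Expr.deg]
    rw [abs_mul, mul_add, pow_add]
    exact mul_le_mul iha ihc (abs_nonneg _) (by positivity)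
  | div a c iha ihc =>
    simp only [Expr.eval, Expr.deg]
    -- Integer division never increases the absolute value, not even by a zero divisor, where the
    -- quotient is `0`.
    have h1 : |a.eval s / c.eval s| ≤ |a.eval s| := by
      rw [← Int.natCast_natAbs, ← Int.natCast_natAbs (a.eval s)]
      exact_mod_cast Int.natAbs_ediv_le_natAbs _ _
    exact (h1.trans iha).trans (pow_le_pow_right₀ (by norm_num) (Nat.mul_le_mul_left _ (by omega)))

theorem Expr.cost_le {b : ℕ} {s : Store} (hb : 1 ≤ b) (hs : Bounded b s) (e : Expr) :
    e.cost s ≤ b * e.weight := by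
  have key : ∀ e : Expr, intCost (e.eval s) ≤ b * (e.deg + 2) := fun e =>
    intCost_le hb (e.abs_eval_le hb hs)
  induction e with
  | const c => exact key (.const c)
  | get x i ih =>
    have := key (.get x i)
    simp only [Expr.cost, Expr.weight, Expr.deg] at *
    linarith
  | add a c iha ihc =>
    have := key (.add a c)
    simp only [Expr.cost, Expr.weight, Expr.deg] at *
    linarith
  | sub a c iha ihc =>
    have := key (.sub a c)
    simp only [Expr.cost, Expr.weight, Expr.deg] at *
    linarith
  | mul a c iha ihc =>
    have := key (.mul a c)
    simp only [Expr.cost, Expr.weight, Expr.deg] at *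
    linarith
  | div a c iha ihc =>
    have := key (.div a c)
    simp only [Expr.cost, Expr.weight, Expr.deg] at *
    linarith

/-! ### Total correctness with costs -/

/-- The cost of running every instruction of a program once, on a memory bounded by `2 ^ b` and up
to the factor `b`. -/
def Prog.weight : Prog → ℕ
  | .skip => 1
  | .assign _ i e => i.weight + e.weight + 1
  | .seq p q => p.weight + q.weight
  | .ite e p q => e.weight + 1 + (p.weight + q.weight)
  | .loop e p => e.weight + 1 + p.weight

/-- Started on `s`, if that is bounded by `2 ^ b`, the program `p` halts within `b * R` times its
weight, with a memory that is bounded by `2 ^ b` again and satisfies `Q`. -/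
def Runs (b R : ℕ) (p : Prog) (s : Store) (Q : Store → Prop) : Prop :=
  1 ≤ b → 1 ≤ R → Bounded b s →
    ∃ t s', Exec p s t s' ∧ t ≤ b * R * p.weight ∧ Bounded b s' ∧ Q s'

variable {b R : ℕ} {s : Store} {Q : Store → Prop}

theorem Runs.seq {p q : Prog} (h : Runs b R p s fun s' => Runs b R q s' Q) :
    Runs b R (.seq p q) s Q := fun hb hR hs => by
  obtain ⟨t, s', h1, h2, h3, h4⟩ := h hb hR hs
  obtain ⟨t', s'', h1', h2', h3', h4'⟩ := h4 hb hR h3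
  exact ⟨_, _, .seq h1 h1', by rw [Prog.weight, mul_add]; omega, h3', h4'⟩

theorem Runs.skip (hQ : Q s) : Runs b R .skip s Q := fun hb hR hs =>
  ⟨_, _, .skip s, by rw [Prog.weight]; nlinarith, hs, hQ⟩

theorem Runs.assign {x : ℕ} {i e : Expr} (he : |e.eval s| ≤ 2 ^ b)
    (hQ : Q (Function.update s x (Function.update (s x) (i.eval s) (e.eval s)))) :
    Runs b R (.assign x i e) s Q := fun hb hR hs => by
  refine ⟨_, _, .assign x i e s, ?_, fun y l => ?_, hQ⟩
  · have h1 := i.cost_le hb hs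
    have h2 := e.cost_le hb hs
    calc i.cost s + e.cost s + 1 ≤ b * 1 * (i.weight + e.weight + 1) := by nlinarith
      _ ≤ b * R * (i.weight + e.weight + 1) := by gcongr
  · by_cases hy : y = x
    · subst hy
      by_cases hl : l = i.eval s
      · simpa [hl] using he
      · simpa [hl] using hs y l
    · simpa [hy] using hs y l

theorem Expr.cost_add_one_le (e : Expr) (hb : 1 ≤ b) (hR : 1 ≤ R) (hs : Bounded b s) :
    e.cost s + 1 ≤ b * R * (e.weight + 1) := by
  have h1 := e.cost_le hb hs
  calc e.cost s + 1 ≤ b * 1 * (e.weight + 1) := by nlinarith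
    _ ≤ b * R * (e.weight + 1) := by gcongr

theorem Runs.ite {e : Expr} {p q : Prog} (hp : 0 < e.eval s → Runs b R p s Q)
    (hq : ¬ 0 < e.eval s → Runs b R q s Q) :
    Runs b R (.ite e p q) s Q := fun hb hR hs => by
  have hc := e.cost_add_one_le hb hR hs
  by_cases h : 0 < e.eval s
  · obtain ⟨t, s', h1, h2, h3, h4⟩ := hp h hb hR hs
    exact ⟨_, _, .iteTrue h h1, by rw [Prog.weight, mul_add, mul_add _ p.weight]; omega, h3, h4⟩
  · obtain ⟨t, s', h1, h2, h3, h4⟩ := hq h hb hR hs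
    exact ⟨_, _, .iteFalse h h1, by rw [Prog.weight, mul_add, mul_add _ p.weight]; omega, h3, h4⟩

/-- The weight counts the body once, and the number of rounds goes into the factor `R`, so nested
loops multiply. The bound `n < m` is strict because `n` rounds need `n + 1` tests. -/
theorem Runs.loop {e : Expr} {p : Prog} {m : ℕ} (I : ℕ → Store → Prop) (n : ℕ) (hm : n < m)
    (h0 : I 0 s) (hstep : ∀ i < n, ∀ s, I i s → 0 < e.eval s ∧ Runs b R p s (I (i + 1)))
    (hend : ∀ s, I n s → ¬ 0 < e.eval s ∧ Q s) :
    Runs b (m * R) (.loop e p) s Q := by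
  intro hb hmR hs₀
  have hR : 1 ≤ R := Nat.pos_of_mul_pos_left hmR
  -- From here on `m` is the number of rounds still to come, and the induction runs over it.
  suffices H : ∀ m i, i + m = n → ∀ s, I i s → Bounded b s → ∃ t s', Exec (.loop e p) s t s' ∧
      t ≤ (m + 1) * (b * R * (e.weight + 1 + p.weight)) ∧ Bounded b s' ∧ Q s' by
    obtain ⟨t, s', h1, h2, h3⟩ := H n 0 (by omega) s h0 hs₀
    refine ⟨t, s', h1, h2.trans ?_, h3⟩
    calc (n + 1) * (b * R * (e.weight + 1 + p.weight))
        ≤ m * (b * R * (e.weight + 1 + p.weight)) := by gcongr; omega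
      _ = b * (m * R) * (Prog.loop e p).weight := by rw [Prog.weight]; ring
  intro m
  induction m with
  | zero =>
    rintro i rfl s hI hs
    have hc := e.cost_add_one_le hb hR hs
    exact ⟨_, _, .loopDone (hend s hI).1, by rw [mul_add (b * R)]; omega, hs, (hend s hI).2⟩
  | succ m ih =>
    rintro i hi s hI hs
    have hc := e.cost_add_one_le hb hR hs
    obtain ⟨hpos, hrun⟩ := hstep i (by omega) s hI
    obtain ⟨t, s', h1, h2, h3, h4⟩ := hrun hb hR hs
    obtain ⟨t', s'', h1', h2', h3', h4'⟩ := ih (i + 1) (by omega) s' h4 h3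
    refine ⟨_, _, .loopStep hpos h1 h1', ?_, h3', h4'⟩
    rw [add_mul (m + 1), one_mul, mul_add (b * R)]
    rw [mul_add (b * R)] at h2'
    omega

/-! ### Registers and lists in arrays -/

/-- The content of cell `0` of array `r`. -/
def reg (r : ℕ) : Expr := .get r (.const 0)

def set (r : ℕ) (e : Expr) : Prog := .assign r (.const 0) e

@[simp] theorem eval_reg (r : ℕ) : (reg r).eval s = s r 0 := rfl

theorem Runs.set {r : ℕ} {e : Expr} (he : |e.eval s| ≤ 2 ^ b)
    (hQ : ∀ s' : Store, s' r 0 = e.eval s → (∀ x, x ≠ r → s' x = s x) → Q s') :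
    Runs b R (RAM.set r e) s Q :=
  Runs.assign he (hQ _ (by simp [Expr.eval]) fun x hx => by simp [hx])

/-- Array contents that hold the list `l` from cell `0` on. -/
def ofList (l : List ℤ) : ℤ → ℤ := fun i => if 0 ≤ i then l.getD i.toNat 0 else 0

theorem start_zero (l : List ℤ) : start l 0 = ofList l := by
  funext i
  simp [start, ofList]

theorem start_succ (l : List ℤ) {x : ℕ} (hx : x ≠ 0) : start l x = 0 := by
  funext i
  simp [start, hx]

theorem ofList_natCast (l : List ℤ) (i : ℕ) : ofList l i = l.getD i 0 := by
  simp [ofList]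

/-- A reading position is described by the unread suffix of the input, which can be matched against
the encoding of the remaining clauses. -/
theorem ofList_of_drop {l : List ℤ} {i : ℕ} {a : ℤ} {t : List ℤ} (h : l.drop i = a :: t) :
    ofList l i = a ∧ l.drop (i + 1) = t ∧ i < l.length := by
  have hi : i < l.length := by
    by_contra hc
    simp [List.drop_eq_nil_of_le (not_lt.1 hc)] at h
  rw [List.drop_eq_getElem_cons hi] at h
  injection h with h1 h2
  exact ⟨by simp [ofList_natCast, hi, h1], h2, hi⟩

theorem update_ofList (l : List ℤ) (v : ℤ) :
    Function.update (ofList l) (l.length : ℤ) v = ofList (l ++ [v]) := by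
  funext i
  by_cases hi : i = l.length
  · subst hi
    simp [ofList]
  · rw [Function.update_of_ne hi]
    unfold ofList
    split_ifs with h
    · obtain ⟨m, rfl⟩ := Int.eq_ofNat_of_zero_le h
      have hm : m ≠ l.length := by exact_mod_cast hi
      simp only [Int.toNat_natCast, List.getD_eq_getElem?_getD]
      rcases lt_or_gt_of_ne hm with h' | h'
      · rw [List.getElem?_append_left h']
      · rw [List.getElem?_eq_none (by omega), List.getElem?_eq_none (by simp; omega)]
    · rfl

end RAM

/-! ### Polygons inscribed in a parabola -/

/-- The point with abscissa `x` on the parabola `y = x ^ 2`. -/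
def onParabola (x : ℤ) : ℤ × ℤ := (x, x * x)

theorem onParabola_injective : Function.Injective onParabola := fun _ _ h => congrArg Prod.fst h

/-- A Vandermonde determinant: increasing abscissae give left turns only. -/
theorem orient_onParabola (a b c : ℤ) :
    orient (onParabola a) (onParabola b) (onParabola c) = (b - a) * (c - a) * (c - b) := by
  simp only [orient, onParabola]
  ring

theorem isConvexPolygon_map_onParabola {l : List ℤ} (hl : l.Pairwise (· < ·)) (h3 : 3 ≤ l.length) :
    IsConvexPolygon (l.map onParabola) := by
  refine ⟨by simpa using h3, fun i j m hij hjm => ?_⟩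
  have hlt : ∀ (i j : ℕ) (hi : i < l.length) (hj : j < l.length), i < j → l[i] < l[j] :=
    List.pairwise_iff_getElem.1 hl
  have hi : (i : ℕ) < l.length := by simpa using i.2
  have hj : (j : ℕ) < l.length := by simpa using j.2
  have hm : (m : ℕ) < l.length := by simpa using m.2
  have h1 := hlt i j hi hj hij
  have h2 := hlt j m hj hm hjm
  simp only [List.get_eq_getElem, List.getElem_map, orient_onParabola]
  have h3 : l[(i : ℕ)] < l[(m : ℕ)] := h1.trans h2
  exact mul_pos (mul_pos (by linarith) (by linarith)) (by linarith)

/-- A point of the parabola lies in an inscribed polygon only if it is a vertex. -/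
theorem toPlane_onParabola_mem_region {l : List ℤ} {x : ℤ} :
    toPlane (onParabola x) ∈ region (l.map onParabola) ↔ x ∈ l := by
  constructor
  · intro h
    by_contra hx
    -- The open half plane above the tangent at `x`. At abscissa `y` of the parabola the defining
    -- expression equals `(y - x) ^ 2`, so all vertices lie in it but the point itself does not.
    let H : Set (ℝ × ℝ) := {p | 0 < p.2 - 2 * x * p.1 + (x : ℝ) ^ 2}
    have hH : Convex ℝ H := by
      intro p hp q hq a b ha hb hab
      simp only [H, Set.mem_ofPred_eq, Prod.fst_add, Prod.snd_add, Prod.smul_fst, Prod.smul_snd,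
        smul_eq_mul] at hp hq ⊢
      have key : a * p.2 + b * q.2 - 2 * x * (a * p.1 + b * q.1) + (x : ℝ) ^ 2 =
          a * (p.2 - 2 * x * p.1 + (x : ℝ) ^ 2) + b * (q.2 - 2 * x * q.1 + (x : ℝ) ^ 2) := by
        linear_combination (-(x : ℝ) ^ 2) * hab
      rw [key]
      rcases ha.eq_or_lt with rfl | ha'
      · rw [zero_add] at hab
        subst hab
        linarith
      · have := mul_pos ha' hp
        have := mul_nonneg hb hq.le
        linarith
    have hsub : region (l.map onParabola) ⊆ H := by
      refine convexHull_min ?_ hH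
      rintro p ⟨q, hq, rfl⟩
      obtain ⟨y, hy, rfl⟩ := List.mem_map.1 hq
      have hne : (y : ℝ) - x ≠ 0 := by
        rw [sub_ne_zero]
        exact_mod_cast fun h : y = x => hx (h ▸ hy)
      have := pow_pos (abs_pos.2 hne) 2
      rw [sq_abs] at this
      simp only [H, toPlane, onParabola, Set.mem_ofPred_eq, Int.cast_mul]
      nlinarith
    have := hsub h
    simp only [H, toPlane, onParabola, Set.mem_ofPred_eq, Int.cast_mul] at this
    nlinarith
  · intro h
    exact subset_convexHull ℝ _ ⟨_, List.mem_map_of_mem h, rfl⟩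

/-! ### The instance built from a formula -/

namespace CNF

variable (φ : CNF) (k : ℕ)

/-- The variables are divided into `k` groups of this many variables each; the last groups may be
incomplete. -/
def groupSize : ℕ := φ.numVars / k + 1

/-- The number of pairs of a group and an assignment to its variables. Such a pair is coded by a
number: the quotient by `2 ^ groupSize` is the group, the low bits are the assignment. -/
def numCodes : ℕ := k * 2 ^ φ.groupSize k

/-- The number of points: one for each clause and one for each group. -/
def numPoints : ℕ := φ.clauses.length + k

/-- The partial assignment with code `j` makes a literal true. -/
def literalTrue (g j : ℕ) {n : ℕ} (l : Fin n × Bool) : Bool :=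
  decide (l.1.val / g = j / 2 ^ g) && (j.testBit (l.1.val % g) == l.2)

def clauseTrue (g j : ℕ) {n : ℕ} (c : List (Fin n × Bool)) : Bool := c.any (literalTrue g j)

/-- The abscissa that represents the clause number `m` in the polygon with code `j`: the one of the
clause's point if the clause is satisfied, and an unused one otherwise. -/
def clauseAbscissa (j m : ℕ) : ℤ :=
  2 * m - φ.numPoints k + if clauseTrue (φ.groupSize k) j (φ.clauses.getD m []) then 0 else 1

/-- The abscissae of the vertices of the polygon with code `j`. -/
def abscissae (j : ℕ) : List ℤ :=
  -- The first and the last abscissa belong to no point. The first ensures three vertices even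
  -- without clauses; the last is peculiar to `j` and keeps the polygons distinct. The group's point
  -- is the vertex before the last.
  [-(φ.numPoints k : ℤ) - 1] ++ (List.range φ.clauses.length).map (φ.clauseAbscissa k j) ++
    [2 * ((φ.clauses.length + j / 2 ^ φ.groupSize k : ℕ) : ℤ) - φ.numPoints k] ++
    [(φ.numPoints k : ℤ) + j]

theorem length_abscissae (j : ℕ) : (φ.abscissae k j).length = φ.clauses.length + 3 := by
  simp [abscissae]

theorem group_lt {j : ℕ} (hj : j < φ.numCodes k) : j / 2 ^ φ.groupSize k < k :=
  Nat.div_lt_of_lt_mul (by rwa [mul_comm])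

/-- Each clause owns two consecutive integers, disjoint from those of the other clauses. This
settles the order of the abscissae and all possible coincidences. -/
theorem clauseAbscissa_mem (j m : ℕ) : 2 * (m : ℤ) - φ.numPoints k ≤ φ.clauseAbscissa k j m ∧
    φ.clauseAbscissa k j m ≤ 2 * m - φ.numPoints k + 1 := by
  unfold clauseAbscissa
  split_ifs <;> constructor <;> linarith

theorem pairwise_abscissae {j : ℕ} (hj : j < φ.numCodes k) :
    (φ.abscissae k j).Pairwise (· < ·) := by
  have hg := φ.group_lt k hj
  have hD : φ.numPoints k = φ.clauses.length + k := rfl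
  have hp : ((List.range φ.clauses.length).map (φ.clauseAbscissa k j)).Pairwise (· < ·) := by
    rw [List.pairwise_map]
    refine List.pairwise_lt_range.imp fun {a b} hab => ?_
    have := φ.clauseAbscissa_mem k j a
    have := φ.clauseAbscissa_mem k j b
    omega
  unfold abscissae
  generalize j / 2 ^ φ.groupSize k = g at hg ⊢
  simp only [List.pairwise_append, List.pairwise_singleton, hp, List.mem_append, List.mem_singleton,
    List.mem_map, List.mem_range, true_and]
  refine ⟨⟨?_, ?_⟩, ?_⟩
  · rintro _ rfl _ ⟨m, hm, rfl⟩
    have := φ.clauseAbscissa_mem k j m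
    omega
  · rintro _ (rfl | ⟨m, hm, rfl⟩) _ rfl
    · omega
    · have := φ.clauseAbscissa_mem k j m
      omega
  · rintro _ ((rfl | ⟨m, hm, rfl⟩) | rfl) _ rfl
    · omega
    · have := φ.clauseAbscissa_mem k j m
      omega
    · omega

/-- All abscissae but the last are below `numPoints`. This separates even codes that differ only in
bits without a variable. -/
theorem mem_abscissae_unique {i j : ℕ} (hi : i < φ.numCodes k) :
    (φ.numPoints k + (j : ℤ)) ∈ φ.abscissae k i ↔ i = j := by
  have hg := φ.group_lt k hi
  have hD : φ.numPoints k = φ.clauses.length + k := rfl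
  unfold abscissae
  generalize i / 2 ^ φ.groupSize k = g at hg ⊢
  simp only [List.mem_append, List.mem_singleton, List.mem_map, List.mem_range]
  constructor
  · rintro (((h | ⟨m, hm, h⟩) | h) | h)
    · omega
    · have := φ.clauseAbscissa_mem k i m
      omega
    · omega
    · omega
  · rintro rfl
    simp

/-- Points have even distance from `-numPoints`, while unsatisfied clauses take odd positions. The
group's vertex has an index beyond the clauses, and the two outer vertices lie outside the range of
the points. -/
theorem mem_abscissae_clause {j m : ℕ} (hm : m < φ.clauses.length) :
    (2 * (m : ℤ) - φ.numPoints k) ∈ φ.abscissae k j ↔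
      clauseTrue (φ.groupSize k) j (φ.clauses.getD m []) = true := by
  have hD : φ.numPoints k = φ.clauses.length + k := rfl
  unfold abscissae
  generalize j / 2 ^ φ.groupSize k = g
  simp only [List.mem_append, List.mem_singleton, List.mem_map, List.mem_range]
  constructor
  · rintro (((h | ⟨m', hm', h⟩) | h) | h)
    · omega
    · have := φ.clauseAbscissa_mem k j m'
      obtain rfl : m' = m := by omega
      unfold clauseAbscissa at h
      by_contra hc
      rw [if_neg hc] at h
      omega
    · omega
    · omega
  · intro h
    exact Or.inl (Or.inl (Or.inr ⟨m, hm, by rw [clauseAbscissa, if_pos h, add_zero]⟩))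

theorem mem_abscissae_group {g j : ℕ} (hg : g < k) :
    (2 * ((φ.clauses.length + g : ℕ) : ℤ) - φ.numPoints k) ∈ φ.abscissae k j ↔
      j / 2 ^ φ.groupSize k = g := by
  have hD : φ.numPoints k = φ.clauses.length + k := rfl
  unfold abscissae
  generalize j / 2 ^ φ.groupSize k = g'
  simp only [List.mem_append, List.mem_singleton, List.mem_map, List.mem_range]
  constructor
  · rintro (((h | ⟨m, hm, h⟩) | h) | h)
    · omega
    · have := φ.clauseAbscissa_mem k j m
      omega
    · omega
    · omega
  · rintro rfl
    simp

/-- One polygon for each partial assignment, and one point for each clause and each group. -/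
def toCover : CoverInstance where
  polygons := (List.range (φ.numCodes k)).map fun j => (φ.abscissae k j).map onParabola
  points := (List.range (φ.numPoints k)).map fun i : ℕ => onParabola (2 * i - φ.numPoints k)
  convex := by
    simp only [List.mem_map, List.mem_range]
    rintro _ ⟨j, hj, rfl⟩
    exact isConvexPolygon_map_onParabola (φ.pairwise_abscissae k hj)
      (by rw [length_abscissae]; omega)
  polygons_distinct := by
    rw [List.pairwise_map]
    refine List.pairwise_lt_range.imp_of_mem fun {i j} hi hj hij h => ?_
    rw [List.mem_range] at hi hj
    have h1 := toPlane_onParabola_mem_region.2 ((φ.mem_abscissae_unique k hj).2 rfl)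
    rw [← h, toPlane_onParabola_mem_region, φ.mem_abscissae_unique k hi] at h1
    exact hij.ne h1
  points_distinct := by
    refine List.nodup_range.map fun i j h => ?_
    have := onParabola_injective h
    omega

theorem card_toCover : (φ.toCover k).card = φ.numCodes k + φ.numPoints k := by
  simp [toCover, CoverInstance.card]

theorem le_numCodes : k ≤ φ.numCodes k := Nat.le_mul_of_pos_right _ (by positivity)

theorem compact_toCover (hk : 3 ≤ k) : (φ.toCover k).Compact := by
  have hD : φ.numPoints k = φ.clauses.length + k := rfl
  have hN := φ.le_numCodes k
  have key : ∀ x : ℤ, |x| ≤ ((φ.numCodes k + φ.numPoints k : ℕ) : ℤ) →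
      |(onParabola x).1| ≤ ((φ.numCodes k + φ.numPoints k : ℕ) : ℤ) ^ 2 ∧
      |(onParabola x).2| ≤ ((φ.numCodes k + φ.numPoints k : ℕ) : ℤ) ^ 2 := by
    intro x hx
    have h1 : (1 : ℤ) ≤ ((φ.numCodes k + φ.numPoints k : ℕ) : ℤ) := by omega
    simp only [onParabola, abs_mul]
    constructor <;> nlinarith [abs_nonneg x]
  unfold CoverInstance.Compact
  rw [card_toCover]
  refine ⟨fun v hv => ?_, fun q hq => ?_⟩
  · simp only [toCover, List.mem_map, List.mem_range] at hv
    obtain ⟨j, hj, rfl⟩ := hv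
    refine ⟨by rw [List.length_map, length_abscissae]; omega, fun q hq => ?_⟩
    obtain ⟨x, hx, rfl⟩ := List.mem_map.1 hq
    apply key
    have hg := φ.group_lt k hj
    unfold abscissae at hx
    generalize j / 2 ^ φ.groupSize k = g at hg hx
    simp only [List.mem_append, List.mem_singleton, List.mem_map, List.mem_range] at hx
    rw [abs_le]
    rcases hx with ((rfl | ⟨m, hm, rfl⟩) | rfl) | rfl
    · omega
    · have := φ.clauseAbscissa_mem k j m
      omega
    · omega
    · omega
  · simp only [toCover, List.mem_map, List.mem_range] at hq
    obtain ⟨i, hi, rfl⟩ := hq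
    apply key
    rw [abs_le]
    omega

/-- The assignments to the single groups, as codes, and the assignments to all variables are
in correspondence, so that a cover by `k` polygons amounts to a satisfying assignment. -/
theorem hasCover_toCover (hk : 0 < k) : (φ.toCover k).HasCover k ↔ φ.Satisfiable := by
  have hlen : (φ.toCover k).polygons.length = φ.numCodes k := by simp [toCover]
  have hmem : ∀ (i : ℕ) (j : Fin (φ.toCover k).polygons.length),
      toPlane (onParabola (2 * i - φ.numPoints k)) ∈ region ((φ.toCover k).polygons.get j) ↔
        (2 * (i : ℤ) - φ.numPoints k) ∈ φ.abscissae k j := by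
    intro i j
    rw [← toPlane_onParabola_mem_region, List.get_eq_getElem]
    simp only [toCover, List.getElem_map, List.getElem_range]
  have hpts : ∀ S : Finset (Fin (φ.toCover k).polygons.length),
      (∀ p ∈ (φ.toCover k).points, ∃ i ∈ S, toPlane p ∈ region ((φ.toCover k).polygons.get i)) ↔
      (∀ m < φ.clauses.length, ∃ j ∈ S,
        clauseTrue (φ.groupSize k) j (φ.clauses.getD m []) = true) ∧
      ∀ g < k, ∃ j ∈ S, j.val / 2 ^ φ.groupSize k = g := by
    intro S
    constructor
    · intro h
      have h' : ∀ i < φ.numPoints k, ∃ j ∈ S,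
          (2 * (i : ℤ) - φ.numPoints k) ∈ φ.abscissae k (Fin.val j) := by
        intro i hi
        obtain ⟨j, hj, hc⟩ := h (onParabola (2 * i - φ.numPoints k))
          (List.mem_map.2 ⟨i, List.mem_range.2 hi, rfl⟩)
        exact ⟨j, hj, (hmem i j).1 hc⟩
      refine ⟨fun m hm => ?_, fun g hg => ?_⟩
      · obtain ⟨j, hj, hc⟩ := h' m (by unfold numPoints; omega)
        exact ⟨j, hj, (φ.mem_abscissae_clause k hm).1 hc⟩
      · obtain ⟨j, hj, hc⟩ := h' (φ.clauses.length + g) (by unfold numPoints; omega)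
        exact ⟨j, hj, (φ.mem_abscissae_group k hg).1 hc⟩
    · rintro ⟨h1, h2⟩ p hp
      obtain ⟨i, hi, rfl⟩ := List.mem_map.1 hp
      rw [List.mem_range] at hi
      rcases lt_or_ge i φ.clauses.length with hm | hm
      · obtain ⟨j, hj, hc⟩ := h1 i hm
        exact ⟨j, hj, (hmem i j).2 ((φ.mem_abscissae_clause k hm).2 hc)⟩
      · obtain ⟨g, rfl⟩ := Nat.exists_eq_add_of_le hm
        have hg : g < k := by unfold numPoints at hi; omega
        obtain ⟨j, hj, hc⟩ := h2 g hg
        exact ⟨j, hj, (hmem _ j).2 ((φ.mem_abscissae_group k hg).2 hc)⟩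
  have hgs : 0 < φ.groupSize k := Nat.succ_pos _
  have hvar : ∀ v : Fin φ.numVars, v.val / φ.groupSize k < k := fun v => by
    refine Nat.div_lt_of_lt_mul (v.2.trans ?_)
    unfold groupSize
    have := Nat.div_add_mod φ.numVars k
    have := Nat.mod_lt φ.numVars hk
    nlinarith
  unfold CoverInstance.HasCover Satisfiable
  constructor
  · rintro ⟨S, hS, hcov⟩
    obtain ⟨hcl, hgr⟩ := (hpts S).1 hcov
    -- Pigeonhole: the `k` chosen polygons meet all `k` groups, hence each group exactly once.
    have hinj := Finset.injOn_of_surjOn_of_card_le (s := S) (t := Finset.range k)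
      (fun j => j.val / 2 ^ φ.groupSize k)
      (fun j _ => by simpa using φ.group_lt k (hlen ▸ j.2))
      (fun g hg => by
        obtain ⟨j, hj, h⟩ := hgr g (by simpa using hg)
        exact ⟨j, hj, h⟩)
      (by simp [hS])
    choose f hfS hf using hgr
    refine ⟨fun v => (f _ (hvar v)).val.testBit (v.val % φ.groupSize k), fun c hc => ?_⟩
    obtain ⟨m, hm, rfl⟩ := List.getElem_of_mem hc
    obtain ⟨j, hj, ht⟩ := hcl m hm
    rw [List.getD_eq_getElem _ _ hm, clauseTrue, List.any_eq_true] at ht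
    obtain ⟨l, hl, ht⟩ := ht
    simp only [literalTrue, Bool.and_eq_true, decide_eq_true_eq, beq_iff_eq] at ht
    refine ⟨l, hl, ?_⟩
    -- The polygon covering the clause is the one from which the assignment takes its value at
    -- `l.1`, since both belong to the same group.
    have : f _ (hvar l.1) = j := hinj (hfS _ _) hj ((hf _ _).trans ht.1)
    simpa only [this] using ht.2
  · rintro ⟨a, ha⟩
    -- Bits of an incomplete group that stand for no variable are set to `false`.
    let r : ℕ → ℕ := fun g => Nat.ofBits fun i : Fin (φ.groupSize k) =>
      if h : g * φ.groupSize k + i < φ.numVars then a ⟨_, h⟩ else false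
    let code : ℕ → ℕ := fun g => 2 ^ φ.groupSize k * g + r g
    have hr : ∀ g, r g < 2 ^ φ.groupSize k := fun g => Nat.ofBits_lt_two_pow _
    have hcode : ∀ g, code g / 2 ^ φ.groupSize k = g := fun g => by
      simp only [code]
      rw [Nat.mul_add_div (by positivity), Nat.div_eq_of_lt (hr g), add_zero]
    have hlt : ∀ g : Fin k, code g < (φ.toCover k).polygons.length := fun g => by
      rw [hlen, numCodes]
      have h1 : (g : ℕ) + 1 ≤ k := g.2
      have h2 := hr g
      simp only [code]
      nlinarith
    have hbit : ∀ v : Fin φ.numVars,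
        (code (v.val / φ.groupSize k)).testBit (v.val % φ.groupSize k) = a v := fun v => by
      have hm := Nat.mod_lt v.val hgs
      have hv : v.val / φ.groupSize k * φ.groupSize k + v.val % φ.groupSize k = v.val :=
        Nat.div_add_mod' _ _
      simp only [code]
      rw [Nat.testBit_two_pow_mul_add _ (hr _), if_pos hm]
      simp only [r]
      rw [Nat.testBit_ofBits_lt _ _ hm]
      simp [hv]
    let F : Fin k → Fin (φ.toCover k).polygons.length := fun g => ⟨code g, hlt g⟩
    have hF : Function.Injective F := fun g g' h => by
      have := congrArg (fun j => Fin.val j / 2 ^ φ.groupSize k) h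
      simpa [F, hcode, Fin.ext_iff] using this
    refine ⟨Finset.univ.map ⟨F, hF⟩, by simp, (hpts _).2 ⟨fun m hm => ?_, fun g hg => ?_⟩⟩
    · obtain ⟨l, hl, h⟩ := ha _ (List.getElem_mem hm)
      refine ⟨F ⟨_, hvar l.1⟩, by simp, ?_⟩
      rw [List.getD_eq_getElem _ _ hm, clauseTrue, List.any_eq_true]
      refine ⟨l, hl, ?_⟩
      simp [literalTrue, F, hcode, hbit, h]
    · exact ⟨F ⟨g, hg⟩, by simp, hcode g⟩

end CNF

/-! ### A program that computes the instance

Array `0` holds the formula, array `1` stays empty and array `20` receives the instance. Of the other arrays, `3` is a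
table of powers of `2` and the others serve as registers: `2` for the size of the groups, `4` for
the number of assignments to a group, `5` for the number of codes, `6` for the number of points,
`7` for the length of the output, `8` for the code, `9` for the position in the input, `10` for the
clause, `11` for the number of literals left, `12` for the truth value of the clause, `13` for the
abscissa, `14` for a counter, and `15` and `16` for variable and sign of the literal. -/

namespace CNF

open RAM

theorem length_encode_pos (φ : CNF) : 2 ≤ φ.encode.length := by simp [encode]

/-- Both coordinates of a point on the parabola. -/
def pointCode (x : ℤ) : List ℤ := [x, x * x]

/-- What the program knows about the memory after the output `l`. -/
structure Holds (φ : CNF) (k : ℕ) (l : List ℤ) (s : Store) : Prop where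
  input : s 0 = ofList φ.encode
  answer : s 1 = 0
  groupSize : s 2 0 = φ.groupSize k
  pow : ∀ i ≤ φ.groupSize k, s 3 (i : ℕ) = 2 ^ i
  block : s 4 0 = 2 ^ φ.groupSize k
  numCodes : s 5 0 = φ.numCodes k
  numPoints : s 6 0 = φ.numPoints k
  position : s 7 0 = l.length
  output : s 20 = ofList l
  unused : ∀ x, 20 < x → s x = 0

/-- The bound `2 ^ b` exceeds all numbers that occur in the computation. -/
structure Fits (φ : CNF) (k b : ℕ) : Prop where
  input : (φ.encode.length : ℤ) ≤ 2 ^ b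
  entry : ∀ z ∈ φ.encode, |z| ≤ 2 ^ b
  numVars : (φ.numVars : ℤ) + 1 ≤ 2 ^ b
  square : ((φ.numCodes k + φ.numPoints k + 2 : ℕ) : ℤ) ^ 2 ≤ 2 ^ b
  -- The length of the encoded instance: three counts, `1 + 2 * (clauses + 3)` numbers per polygon,
  -- two per point.
  output : 3 + (φ.numCodes k : ℤ) * (2 * φ.clauses.length + 7) + 2 * φ.numPoints k ≤ 2 ^ b

/-! ### Invariants of the memory and writing to the output -/

section

variable {φ : CNF} {k b R : ℕ} {l : List ℤ} {s : Store} {Q : Store → Prop}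

/-- Arrays `8` to `19` are scratch space that the invariant does not mention. -/
theorem Holds.congr {s' : Store} (h : Holds φ k l s) (hs : ∀ x, x < 8 ∨ 20 ≤ x → s' x = s x) :
    Holds φ k l s' where
  input := by rw [hs 0 (by omega), h.input]
  answer := by rw [hs 1 (by omega), h.answer]
  groupSize := by rw [hs 2 (by omega), h.groupSize]
  pow := by rw [hs 3 (by omega)]; exact h.pow
  block := by rw [hs 4 (by omega), h.block]
  numCodes := by rw [hs 5 (by omega), h.numCodes]
  numPoints := by rw [hs 6 (by omega), h.numPoints]
  position := by rw [hs 7 (by omega), h.position]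
  output := by rw [hs 20 (by omega), h.output]
  unused x hx := by rw [hs x (by omega), h.unused x hx]

theorem Holds.eval_numClauses (h : Holds φ k l s) : s 0 1 = φ.clauses.length := by
  rw [h.input]; rfl

theorem Fits.abs_le (hb : Fits φ k b) {x : ℤ}
    (hx : |x| ≤ ((φ.numCodes k + φ.numPoints k + 2 : ℕ) : ℤ)) :
    |x| ≤ 2 ^ b ∧ |x * x| ≤ 2 ^ b := by
  have h := hb.square
  have h1 : (1 : ℤ) ≤ ((φ.numCodes k + φ.numPoints k + 2 : ℕ) : ℤ) := by omega
  rw [abs_mul]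
  constructor <;> nlinarith [abs_nonneg x]

/-- Append a number to the output. -/
def emit (e : Expr) : Prog :=
  .seq (.assign 20 (reg 7) e) (RAM.set 7 (.add (reg 7) (.const 1)))

theorem runs_emit {e : Expr} {v : ℤ} (h : Holds φ k l s) (hv : e.eval s = v) (he : |v| ≤ 2 ^ b)
    (hl : (l.length : ℤ) + 1 ≤ 2 ^ b)
    (hQ : ∀ s', Holds φ k (l ++ [v]) s' → (∀ x, 8 ≤ x → x < 20 → s' x = s x) → Q s') :
    Runs b R (emit e) s Q := by
  subst hv
  refine Runs.seq (Runs.assign he ?_)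
  refine Runs.set ?_ fun s' h1 h2 => hQ s' ?_ ?_
  · simp only [Expr.eval, eval_reg, Function.update_of_ne (show 7 ≠ 20 by decide), h.position]
    rw [abs_of_nonneg (by positivity)]
    exact hl
  · have h3 : ∀ x, x ≠ 7 → x ≠ 20 → s' x = s x := fun x h7 h20 => by
      rw [h2 x h7, Function.update_of_ne h20]
    constructor
    · rw [h3 0 (by decide) (by decide), h.input]
    · rw [h3 1 (by decide) (by decide), h.answer]
    · rw [h3 2 (by decide) (by decide), h.groupSize]
    · rw [h3 3 (by decide) (by decide)]; exact h.pow
    · rw [h3 4 (by decide) (by decide), h.block]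
    · rw [h3 5 (by decide) (by decide), h.numCodes]
    · rw [h3 6 (by decide) (by decide), h.numPoints]
    · rw [h1]
      simp [Expr.eval, h.position]
    · rw [h2 20 (by decide)]
      simp [h.position, h.output, update_ofList]
    · intro x hx
      rw [h3 x (by omega) (by omega), h.unused x hx]
  · intro x h8 h20
    rw [h2 x (by omega), Function.update_of_ne (by omega)]

/-- Append the point with a given abscissa to the output. -/
def emitPoint (e : Expr) : Prog :=
  .seq (RAM.set 13 e) (.seq (emit (reg 13)) (emit (.mul (reg 13) (reg 13))))

theorem runs_emitPoint {e : Expr} {v : ℤ} (hb : Fits φ k b) (h : Holds φ k l s)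
    (hv : e.eval s = v) (he : |v| ≤ ((φ.numCodes k + φ.numPoints k + 2 : ℕ) : ℤ))
    (hl : (l.length : ℤ) + 2 ≤ 2 ^ b)
    (hQ : ∀ s', Holds φ k (l ++ pointCode v) s' →
      (∀ x, 8 ≤ x → x < 20 → x ≠ 13 → s' x = s x) → Q s') :
    Runs b R (emitPoint e) s Q := by
  obtain ⟨hv1, hv2⟩ := hb.abs_le he
  subst hv
  refine Runs.seq (Runs.set hv1 fun s₁ h1 h1' => ?_)
  refine Runs.seq (runs_emit (h.congr fun x hx => h1' x (by omega)) h1 hv1 (by omega)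
    fun s₂ h2 h2' => ?_)
  refine runs_emit h2 (v := e.eval s * e.eval s) ?_ hv2 (by simp; omega)
    fun s₃ h3 h3' => hQ s₃ ?_ ?_
  · simp [Expr.eval, h2' 13, h1]
  · simpa [pointCode] using h3
  · intro x h8 h20 h13
    rw [h3' x h8 h20, h2' x h8 h20, h1' x h13]

/-! #### Evaluating a literal -/

def sqDiff (a b : Expr) : Expr := .mul (.sub a b) (.sub a b)

/-- The code, shifted so that its lowest bit belongs to the variable in register `15`. -/
def shiftedCode : Expr :=
  .div (reg 8) (.get 3 (.sub (reg 15) (.mul (reg 2) (.div (reg 15) (reg 2)))))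

/-- Positive if the code in register `8` makes the literal in registers `15` and `16` true. -/
def literalTest : Expr :=
  .sub (.sub (.const 1) (sqDiff (.div (reg 15) (reg 2)) (.div (reg 8) (reg 4))))
    (sqDiff (.sub shiftedCode (.mul (.const 2) (.div shiftedCode (.const 2)))) (reg 16))

/-- The test evaluates to `1 - x ^ 2 - y ^ 2`, where `x` compares the groups and `y` the bit with
the sign. For integers this is positive only if both vanish. -/
theorem eval_literalTest {j : ℕ} {n : ℕ} {a : Fin n × Bool} (h : Holds φ k l s) (hj : s 8 0 = j)
    (hv : s 15 0 = (a.1.val : ℤ)) (ha : s 16 0 = if a.2 then 1 else 0) :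
    0 < literalTest.eval s ↔ literalTrue (φ.groupSize k) j a = true := by
  set g := φ.groupSize k with hg
  have hg0 : 0 < g := Nat.succ_pos _
  have hmod : (a.1.val : ℤ) - g * (a.1.val / g) = ((a.1.val % g : ℕ) : ℤ) := by
    rw [Int.natCast_mod, Int.emod_def]
  have hpow := h.pow (a.1.val % g) (Nat.mod_lt _ hg0).le
  set i := a.1.val % g with hi
  have hsh : shiftedCode.eval s = ((j / 2 ^ i : ℕ) : ℤ) := by
    simp only [shiftedCode, Expr.eval, eval_reg, hj, hv, h.groupSize, ← hg, hmod, hpow]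
    push_cast
    rfl
  have hdiv : s 15 0 / s 2 0 = ((a.1.val / g : ℕ) : ℤ) := by
    rw [hv, h.groupSize, Int.natCast_div]
  have hgr : s 8 0 / s 4 0 = ((j / 2 ^ g : ℕ) : ℤ) := by
    rw [hj, h.block]
    push_cast
    rfl
  have hev : literalTest.eval s =
      1 - (((a.1.val / g : ℕ) : ℤ) - ((j / 2 ^ g : ℕ) : ℤ)) ^ 2 -
        (((j / 2 ^ i % 2 : ℕ) : ℤ) - if a.2 then 1 else 0) ^ 2 := by
    have hm : ((j / 2 ^ i : ℕ) : ℤ) - 2 * (((j / 2 ^ i : ℕ) : ℤ) / 2) =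
        ((j / 2 ^ i % 2 : ℕ) : ℤ) := by omega
    simp only [literalTest, sqDiff, Expr.eval, hsh, eval_reg, hdiv, hgr, ha, hm]
    ring
  have hsq : ∀ x y : ℤ, 0 < 1 - x ^ 2 - y ^ 2 ↔ x = 0 ∧ y = 0 := fun x y => by
    constructor
    · intro hxy
      constructor
      · exact pow_eq_zero_iff two_ne_zero |>.1 (by nlinarith [sq_nonneg x, sq_nonneg y])
      · exact pow_eq_zero_iff two_ne_zero |>.1 (by nlinarith [sq_nonneg x, sq_nonneg y])
    · rintro ⟨rfl, rfl⟩
      norm_num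
  rw [hev, hsq, sub_eq_zero, sub_eq_zero, literalTrue, Bool.and_eq_true, decide_eq_true_eq,
    beq_iff_eq, Nat.testBit_eq_decide_div_mod_eq, ← hi]
  refine and_congr (by norm_cast) ?_
  rcases Nat.mod_two_eq_zero_or_one (j / 2 ^ i) with h2 | h2 <;> rw [h2] <;> cases a.2 <;> simp

/-- Read a literal; set register `12` if it is true. -/
def literalStep : Prog :=
  .seq (.ite (.get 0 (reg 9))
      (.seq (RAM.set 15 (.sub (.get 0 (reg 9)) (.const 1))) (RAM.set 16 (.const 1)))
      (.seq (RAM.set 15 (.sub (.sub (.const 0) (.get 0 (reg 9))) (.const 1)))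
        (RAM.set 16 (.const 0)))) <|
  .seq (.ite literalTest (RAM.set 12 (.const 1)) .skip) <|
  .seq (RAM.set 9 (.add (reg 9) (.const 1))) <|
  RAM.set 11 (.sub (reg 11) (.const 1))

theorem Fits.one_le (hb : Fits φ k b) : (1 : ℤ) ≤ 2 ^ b := by
  have := hb.numVars
  omega

theorem runs_literalStep {j p r : ℕ} {a : Fin φ.numVars × Bool} {d : Bool} (hb : Fits φ k b)
    (h : Holds φ k l s) (hj : s 8 0 = j) (hp : s 9 0 = p) (hr : s 11 0 = ((r + 1 : ℕ) : ℤ))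
    (hr' : ((r + 1 : ℕ) : ℤ) ≤ 2 ^ b)
    (hd : s 12 0 = if d then 1 else 0) (ha : ofList φ.encode p = encodeLiteral a)
    (hpl : p < φ.encode.length)
    (hQ : ∀ s', Holds φ k l s' → s' 8 = s 8 → s' 10 = s 10 → s' 9 0 = ((p + 1 : ℕ) : ℤ) →
      s' 11 0 = r →
      (s' 12 0 = if (d || literalTrue (φ.groupSize k) j a) then 1 else 0) → Q s') :
    Runs b R literalStep s Q := by
  have h1 := hb.one_le
  have hn := hb.numVars
  have hv := a.1.2
  have hlit : s 0 (s 9 0) = encodeLiteral a := by rw [h.input, hp, ha]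
  have hdec : ∀ Q' : Store → Prop,
      (∀ s', s' 15 0 = (a.1.val : ℤ) → (s' 16 0 = if a.2 then 1 else 0) →
        (∀ x, x ≠ 15 → x ≠ 16 → s' x = s x) → Q' s') →
      Runs b R (.ite (.get 0 (reg 9))
        (.seq (RAM.set 15 (.sub (.get 0 (reg 9)) (.const 1))) (RAM.set 16 (.const 1)))
        (.seq (RAM.set 15 (.sub (.sub (.const 0) (.get 0 (reg 9))) (.const 1)))
          (RAM.set 16 (.const 0)))) s Q' := by
    intro Q' hQ'
    unfold encodeLiteral at hlit
    refine Runs.ite (fun hpos => ?_) (fun hneg => ?_)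
    · simp only [Expr.eval, eval_reg, hlit] at hpos
      have ht : a.2 = true := by
        by_contra hc
        rw [if_neg hc] at hpos
        omega
      rw [if_pos ht] at hlit
      refine Runs.seq (Runs.set ?_ fun s₁ h₁ h₁' => Runs.set ?_ fun s₂ h₂ h₂' => hQ' s₂ ?_ ?_ ?_)
      · simp only [Expr.eval, eval_reg, hlit]
        rw [abs_le]
        omega
      · simpa [Expr.eval] using h1
      · rw [h₂' 15 (by decide), h₁]
        simp [Expr.eval, hlit]
      · rw [h₂, if_pos ht]
        rfl
      · intro x h15 h16
        rw [h₂' x h16, h₁' x h15]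
    · simp only [Expr.eval, eval_reg, hlit] at hneg
      have ht : ¬ a.2 = true := by
        intro hc
        rw [if_pos hc] at hneg
        omega
      rw [if_neg ht] at hlit
      refine Runs.seq (Runs.set ?_ fun s₁ h₁ h₁' => Runs.set ?_ fun s₂ h₂ h₂' => hQ' s₂ ?_ ?_ ?_)
      · simp only [Expr.eval, eval_reg, hlit]
        rw [abs_le]
        omega
      · simp [Expr.eval]
      · rw [h₂' 15 (by decide), h₁]
        simp [Expr.eval, hlit]
      · rw [h₂, if_neg ht]
        rfl
      · intro x h15 h16
        rw [h₂' x h16, h₁' x h15]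
  refine Runs.seq (hdec _ fun s₁ hv₁ ha₁ h₁ => ?_)
  have H₁ : Holds φ k l s₁ := h.congr fun x hx => h₁ x (by omega) (by omega)
  have htest := eval_literalTest H₁ (by rw [h₁ 8 (by decide) (by decide), hj]) hv₁ ha₁
  have hupd : ∀ Q' : Store → Prop,
      (∀ s', (s' 12 0 = if (d || literalTrue (φ.groupSize k) j a) then 1 else 0) →
        (∀ x, x ≠ 12 → s' x = s₁ x) → Q' s') →
      Runs b R (.ite literalTest (RAM.set 12 (.const 1)) .skip) s₁ Q' := by
    intro Q' hQ'
    refine Runs.ite (fun hpos => ?_) (fun hneg => ?_)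
    · rw [htest] at hpos
      refine Runs.set ?_ fun s₂ h₂ h₂' => hQ' s₂ ?_ h₂'
      · simpa [Expr.eval] using h1
      · rw [h₂, hpos, Bool.or_true]
        rfl
    · rw [htest, Bool.not_eq_true] at hneg
      refine Runs.skip (hQ' s₁ ?_ fun _ _ => rfl)
      rw [hneg, Bool.or_false, h₁ 12 (by decide) (by decide), hd]
  refine Runs.seq (hupd _ fun s₂ hd₂ h₂ => ?_)
  have h12 : ∀ x, x ≠ 12 → x ≠ 15 → x ≠ 16 → s₂ x = s x := fun x a b c => by rw [h₂ x a, h₁ x b c]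
  have hp₂ : s₂ 9 0 = p := by rw [h12 9 (by decide) (by decide) (by decide), hp]
  have hr₂ : s₂ 11 0 = ((r + 1 : ℕ) : ℤ) := by rw [h12 11 (by decide) (by decide) (by decide), hr]
  refine Runs.seq (Runs.set ?_ fun s₃ h₃ h₃' => Runs.set ?_ fun s₄ h₄ h₄' => hQ s₄ ?_ ?_ ?_ ?_ ?_ ?_)
  · have := hb.input
    simp only [Expr.eval, eval_reg, hp₂]
    rw [abs_le]
    omega
  · simp only [Expr.eval, eval_reg, h₃' 11 (by decide), hr₂]
    rw [abs_le]
    omega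
  · exact h.congr fun x hx => by
      rw [h₄' x (by omega), h₃' x (by omega), h12 x (by omega) (by omega) (by omega)]
  · rw [h₄' 8 (by decide), h₃' 8 (by decide), h12 8 (by decide) (by decide) (by decide)]
  · rw [h₄' 10 (by decide), h₃' 10 (by decide), h12 10 (by decide) (by decide) (by decide)]
  · rw [h₄' 9 (by decide), h₃]
    simp [Expr.eval, hp₂]
  · rw [h₄]
    simp [Expr.eval, h₃' 11, hr₂]
  · rw [h₄' 12 (by decide), h₃' 12 (by decide), hd₂]

/-! #### Writing the vertices -/

def clauseCode {n : ℕ} (c : List (Fin n × Bool)) : List ℤ := (c.length : ℤ) :: c.map encodeLiteral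

theorem drop_two_encode (φ : CNF) : φ.encode.drop 2 = φ.clauses.flatMap clauseCode := rfl

/-- Lets the input length bound the loop over the clauses. -/
theorem numClauses_lt (φ : CNF) : φ.clauses.length < φ.encode.length := by
  have h : ∀ L : List (List (Fin φ.numVars × Bool)), L.length ≤ (L.flatMap clauseCode).length := by
    intro L
    induction L with
    | nil => simp
    | cons c L ih =>
      simp only [List.flatMap_cons, List.length_cons, List.length_append, clauseCode]
      omega
  have h1 := h φ.clauses
  rw [← drop_two_encode, List.length_drop] at h1
  have := φ.length_encode_pos
  omega

/-- Read a clause and write the vertex that represents it. -/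
def clauseStep : Prog :=
  .seq (RAM.set 11 (.get 0 (reg 9))) <|
  .seq (RAM.set 9 (.add (reg 9) (.const 1))) <|
  .seq (RAM.set 12 (.const 0)) <|
  .seq (.loop (reg 11) literalStep) <|
  .seq (emitPoint (.sub (.add (.sub (.mul (.const 2) (reg 10)) (reg 6)) (.const 1)) (reg 12))) <|
  RAM.set 10 (.add (reg 10) (.const 1))

theorem runs_clauseStep {j p m : ℕ} {t : List ℤ} (hb : Fits φ k b) (h : Holds φ k l s)
    (hj : s 8 0 = j) (hm : s 10 0 = m) (hm' : m < φ.clauses.length) (hp : s 9 0 = p)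
    (ht : φ.encode.drop p = clauseCode φ.clauses[m] ++ t) (hl : (l.length : ℤ) + 2 ≤ 2 ^ b)
    (hQ : ∀ s', Holds φ k (l ++ pointCode (φ.clauseAbscissa k j m)) s' → s' 8 0 = j →
      s' 10 0 = ((m + 1 : ℕ) : ℤ) →
      (∃ q : ℕ, s' 9 0 = q ∧ φ.encode.drop q = t) → Q s') :
    Runs b (φ.encode.length * 1) clauseStep s Q := by
  set cl := φ.clauses[m] with hc
  have h1 := hb.one_le
  have hin := hb.input
  rw [clauseCode, List.cons_append] at ht
  obtain ⟨hlen, ht', hpl⟩ := ofList_of_drop ht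
  have hcl : cl.length + (p + 1) ≤ φ.encode.length := by
    have := congrArg List.length ht'
    rw [List.length_drop, List.length_append, List.length_map] at this
    omega
  have hlit : ∀ i (hi : i < cl.length), ofList φ.encode ((p + 1 + i : ℕ) : ℤ) = encodeLiteral cl[i] ∧
      p + 1 + i < φ.encode.length := by
    intro i hi
    have : φ.encode.drop (p + 1 + i) =
        encodeLiteral cl[i] :: ((cl.map encodeLiteral).drop (i + 1) ++ t) := by
      rw [← List.drop_drop, ht', List.drop_append_of_le_length (by simp; omega),
        List.drop_eq_getElem_cons (by simpa using hi)]
      simp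
    obtain ⟨h1, -, h2⟩ := ofList_of_drop this
    exact ⟨h1, h2⟩
  refine Runs.seq (Runs.set ?_ fun s₁ h₁ h₁' => ?_)
  · simp only [Expr.eval, eval_reg, h.input, hp, hlen]
    rw [abs_le]
    omega
  simp only [Expr.eval, eval_reg, h.input, hp, hlen] at h₁
  refine Runs.seq (Runs.set ?_ fun s₂ h₂ h₂' => ?_)
  · simp only [Expr.eval, eval_reg, h₁' 9 (by decide), hp]
    rw [abs_le]
    omega
  simp only [Expr.eval, eval_reg, h₁' 9 (by decide), hp] at h₂
  refine Runs.seq (Runs.set ?_ fun s₃ h₃ h₃' => ?_)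
  · simp [Expr.eval]
  have h03 : ∀ x, x ≠ 9 → x ≠ 11 → x ≠ 12 → s₃ x = s x := fun x h9 h11 h12 => by
    rw [h₃' x h12, h₂' x h9, h₁' x h11]
  -- Invariant: after `i` literals, register `12` tells whether one of these `i` is true.
  refine Runs.seq (Runs.loop
    (I := fun i s' => Holds φ k l s' ∧ s' 8 0 = j ∧ s' 10 0 = m ∧ s' 9 0 = ((p + 1 + i : ℕ) : ℤ) ∧
      s' 11 0 = ((cl.length - i : ℕ) : ℤ) ∧
      s' 12 0 = if clauseTrue (φ.groupSize k) j (cl.take i) then 1 else 0)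
    (n := cl.length) (by omega) ⟨h.congr fun x hx => h03 x (by omega) (by omega) (by omega),
      ?_, ?_, ?_, ?_, ?_⟩ ?_ ?_)
  · rw [h03 8 (by decide) (by decide) (by decide), hj]
  · rw [h03 10 (by decide) (by decide) (by decide), hm]
  · rw [h₃' 9 (by decide), h₂]
    push_cast
    ring
  · rw [h₃' 11 (by decide), h₂' 11 (by decide), h₁]
    simp
  · simp [h₃, clauseTrue, Expr.eval]
  · rintro i hi s' ⟨H, e8, e10, e9, e11, e12⟩
    refine ⟨by simp only [eval_reg, e11]; omega, ?_⟩
    obtain ⟨hl1, hl2⟩ := hlit i hi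
    refine runs_literalStep (r := cl.length - (i + 1)) (a := cl[i]) hb H e8 e9
      (by rw [e11]; congr 1; omega) (by omega) e12 hl1 hl2 fun s'' H' f8 f10 f9 f11 f12 => ?_
    refine ⟨H', by rw [f8, e8], by rw [f10, e10], f9, f11, ?_⟩
    rw [f12, clauseTrue, clauseTrue, List.take_succ_eq_append_getElem hi, List.any_append]
    simp
  · rintro s₄ ⟨H, e8, e10, e9, e11, e12⟩
    refine ⟨by simp [e11], ?_⟩
    have hx := φ.clauseAbscissa_mem k j m
    have hD : φ.numPoints k = φ.clauses.length + k := rfl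
    refine Runs.seq (runs_emitPoint (v := φ.clauseAbscissa k j m) hb H ?_ ?_ hl fun s₅ H₅ h₅ => ?_)
    · simp only [Expr.eval, eval_reg, e10, e12, H.numPoints, clauseAbscissa, List.take_length,
        List.getD_eq_getElem _ _ hm', ← hc]
      split_ifs <;> ring
    · rw [abs_le]
      omega
    refine Runs.set ?_ fun s₆ h₆ h₆' => hQ s₆ (H₅.congr fun x hx => h₆' x (by omega)) ?_ ?_ ?_
    · simp only [Expr.eval, eval_reg, h₅ 10 (by decide) (by decide) (by decide), e10]
      have := φ.numClauses_lt
      rw [abs_le]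
      omega
    · rw [h₆' 8 (by decide), h₅ 8 (by decide) (by decide) (by decide), e8]
    · rw [h₆]
      simp [Expr.eval, h₅ 10, e10]
    · refine ⟨_, by rw [h₆' 9 (by decide), h₅ 9 (by decide) (by decide) (by decide), e9], ?_⟩
      rw [← List.drop_drop, ht']
      exact List.drop_left' (by simp)

/-- The part of the output for the polygon with code `j`. -/
def polygonCode (φ : CNF) (k j : ℕ) : List ℤ :=
  ((φ.clauses.length : ℤ) + 3) :: (φ.abscissae k j).flatMap pointCode

theorem length_pointCode (x : ℤ) : (pointCode x).length = 2 := rfl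

theorem length_flatMap_pointCode {α : Type*} (f : α → ℤ) (l : List α) :
    (l.flatMap fun a => pointCode (f a)).length = 2 * l.length := by
  simp [List.length_flatMap, length_pointCode, mul_comm]

theorem length_polygonCode (φ : CNF) (k j : ℕ) :
    (φ.polygonCode k j).length = 2 * φ.clauses.length + 7 := by
  have := length_flatMap_pointCode id (φ.abscissae k j)
  simp only [id] at this
  rw [polygonCode, List.length_cons, this, length_abscissae]
  ring

/-- Write a polygon. -/
def polygonStep : Prog :=
  .seq (emit (.add (.get 0 (.const 1)) (.const 3))) <|
  .seq (emitPoint (.sub (.sub (.const 0) (reg 6)) (.const 1))) <|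
  .seq (RAM.set 9 (.const 2)) <|
  .seq (RAM.set 10 (.const 0)) <|
  .seq (.loop (.sub (.get 0 (.const 1)) (reg 10)) clauseStep) <|
  .seq (emitPoint (.sub (.mul (.const 2) (.add (.get 0 (.const 1)) (.div (reg 8) (reg 4))))
    (reg 6))) <|
  .seq (emitPoint (.add (reg 6) (reg 8))) <|
  RAM.set 8 (.add (reg 8) (.const 1))

/-- The two factors `φ.encode.length` stem from the loop over the clauses and the loop over literals
nested in it. -/
theorem runs_polygonStep {j : ℕ} (hb : Fits φ k b) (h : Holds φ k l s) (hj : s 8 0 = j)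
    (hjN : j < φ.numCodes k) (hl : l.length + (2 * φ.clauses.length + 7) ≤ (2 : ℤ) ^ b)
    (hQ : ∀ s', Holds φ k (l ++ φ.polygonCode k j) s' → s' 8 0 = ((j + 1 : ℕ) : ℤ) → Q s') :
    Runs b (φ.encode.length * (φ.encode.length * 1)) polygonStep s Q := by
  have h1 := hb.one_le
  have hg := φ.group_lt k hjN
  have hD : φ.numPoints k = φ.clauses.length + k := rfl
  have hin := hb.input
  have hM := φ.numClauses_lt
  refine Runs.seq (runs_emit (v := (φ.clauses.length : ℤ) + 3) h ?_ ?_ (by omega)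
    fun s₁ H₁ h₁ => ?_)
  · simp [Expr.eval, h.eval_numClauses]
  · rw [abs_le]
    omega
  refine Runs.seq (runs_emitPoint (v := -(φ.numPoints k : ℤ) - 1) hb H₁ ?_ ?_ ?_
    fun s₂ H₂ h₂ => ?_)
  · simp [Expr.eval, H₁.numPoints]
  · rw [abs_le]
    omega
  · simp only [List.length_append, List.length_singleton]
    omega
  -- The formula is read anew for every polygon; its clauses start behind two header numbers.
  refine Runs.seq (Runs.set ?_ fun s₃ h₃ h₃' => ?_)
  · have := φ.length_encode_pos
    simp only [Expr.eval]
    rw [abs_le]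
    omega
  refine Runs.seq (Runs.set ?_ fun s₄ h₄ h₄' => ?_)
  · simp [Expr.eval]
  set l₁ := l ++ [(φ.clauses.length : ℤ) + 3] ++ pointCode (-(φ.numPoints k : ℤ) - 1) with hl₁
  have hl₁' : l₁.length = l.length + 3 := by simp [hl₁, length_pointCode]
  refine Runs.seq (Runs.loop
    (I := fun m s' =>
      Holds φ k (l₁ ++ (List.range m).flatMap fun m => pointCode (φ.clauseAbscissa k j m)) s' ∧
      s' 8 0 = j ∧ s' 10 0 = m ∧
      ∃ p : ℕ, s' 9 0 = p ∧ φ.encode.drop p = (φ.clauses.drop m).flatMap clauseCode)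
    (n := φ.clauses.length) hM ⟨?_, ?_, ?_, 2, ?_, ?_⟩ ?_ ?_)
  · simpa using H₂.congr fun x hx => by rw [h₄' x (by omega), h₃' x (by omega)]
  · rw [h₄' 8 (by decide), h₃' 8 (by decide), h₂ 8 (by decide) (by decide) (by decide),
      h₁ 8 (by decide) (by decide), hj]
  · rw [h₄]
    rfl
  · rw [h₄' 9 (by decide), h₃]
    rfl
  · rw [drop_two_encode, List.drop_zero]
  · rintro m hm s' ⟨H, e8, e10, p, e9, hp⟩
    refine ⟨?_, ?_⟩
    · simp only [Expr.eval, eval_reg, H.eval_numClauses, e10]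
      omega
    · rw [List.drop_eq_getElem_cons hm, List.flatMap_cons] at hp
      refine runs_clauseStep hb H e8 e10 hm e9 hp ?_ fun s'' H' f8 f10 f9 => ⟨?_, f8, f10, f9⟩
      · rw [List.length_append, length_flatMap_pointCode, List.length_range, hl₁']
        push_cast
        omega
      · simpa [List.range_succ] using H'
  · rintro s₅ ⟨H₅, e8, e10, -⟩
    refine ⟨by simp [Expr.eval, H₅.eval_numClauses, e10], ?_⟩
    refine Runs.seq (runs_emitPoint
      (v := 2 * ((φ.clauses.length + j / 2 ^ φ.groupSize k : ℕ) : ℤ) - φ.numPoints k)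
      hb H₅ ?_ ?_ ?_ fun s₆ H₆ h₆ => ?_)
    · simp [Expr.eval, H₅.eval_numClauses, H₅.numPoints, H₅.block, e8]
    · generalize j / 2 ^ φ.groupSize k = g at hg ⊢
      rw [abs_le]
      omega
    · rw [List.length_append, length_flatMap_pointCode, List.length_range, hl₁']
      push_cast
      omega
    have f8 : s₆ 8 0 = j := by rw [h₆ 8 (by decide) (by decide) (by decide), e8]
    refine Runs.seq (runs_emitPoint (v := (φ.numPoints k : ℤ) + j) hb H₆ ?_ ?_ ?_
      fun s₇ H₇ h₇ => ?_)
    · simp [Expr.eval, H₆.numPoints, f8]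
    · rw [abs_le]
      omega
    · rw [List.length_append, List.length_append, length_flatMap_pointCode, List.length_range,
        hl₁', length_pointCode]
      push_cast
      omega
    have g8 : s₇ 8 0 = j := by rw [h₇ 8 (by decide) (by decide) (by decide), f8]
    refine Runs.set ?_ fun s₈ h₈ h₈' => hQ s₈ ?_ ?_
    · simp only [Expr.eval, eval_reg, g8]
      refine (hb.abs_le ?_).1
      rw [abs_le]
      omega
    · have := H₇.congr (s' := s₈) fun x hx => h₈' x (by omega)
      simpa only [hl₁, polygonCode, abscissae, List.flatMap_append, List.flatMap_map,
        List.flatMap_singleton, List.flatMap_cons, List.flatMap_nil, List.append_nil,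
        List.append_assoc, List.cons_append, List.nil_append] using this
    · rw [h₈]
      simp [Expr.eval, g8]

/-! #### The whole program -/

/-- Compute the powers of `2` up to the number of assignments to a group. -/
def powerStep : Prog :=
  .seq (.assign 3 (.add (reg 14) (.const 1)) (.mul (.const 2) (.get 3 (reg 14))))
    (RAM.set 14 (.add (reg 14) (.const 1)))

/-- Compute the parameters of the instance. -/
def setup (k : ℕ) : Prog :=
  .seq (RAM.set 2 (.add (.div (.get 0 (.const 0)) (.const k)) (.const 1))) <|
  .seq (RAM.set 3 (.const 1)) <|
  .seq (.loop (.sub (reg 2) (reg 14)) powerStep) <|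
  .seq (RAM.set 4 (.get 3 (reg 2))) <|
  .seq (RAM.set 5 (.mul (.const k) (reg 4))) <|
  RAM.set 6 (.add (.get 0 (.const 1)) (.const k))

def pointStep : Prog :=
  .seq (emitPoint (.sub (.mul (.const 2) (reg 14)) (reg 6)))
    (RAM.set 14 (.add (reg 14) (.const 1)))

/-- Translate a formula into an instance of the covering problem. -/
def translate (k : ℕ) : Prog :=
  .seq (setup k) <|
  .seq (emit (.const k)) <|
  .seq (emit (reg 5)) <|
  .seq (.loop (.sub (reg 5) (reg 8)) polygonStep) <|
  .seq (emit (reg 6)) <|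
  .seq (RAM.set 14 (.const 0)) <|
  .loop (.sub (reg 6) (reg 14)) pointStep

theorem runs_setup {m : ℕ} (hk : 0 < k) (hb : Fits φ k b) (hm : φ.groupSize k < m)
    (hQ : ∀ s', Holds φ k [] s' → s' 8 0 = 0 → Q s') :
    Runs b (m * R) (setup k) (start φ.encode) Q := by
  have h1 := hb.one_le
  have hstart : ∀ x, x ≠ 0 → start φ.encode x = 0 := fun x hx => start_succ _ hx
  have hgs : φ.groupSize k ≤ φ.numVars + 1 := Nat.succ_le_succ (Nat.div_le_self _ _)
  have hpow : (2 : ℤ) ^ φ.groupSize k ≤ φ.numCodes k := by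
    exact_mod_cast Nat.le_mul_of_pos_left _ hk
  have hsq := hb.square
  have hN : (φ.numCodes k : ℤ) + φ.numPoints k ≤ 2 ^ b := by
    push_cast at hsq
    nlinarith
  have hn : (Expr.add (.div (.get 0 (.const 0)) (.const k)) (.const 1)).eval (start φ.encode) =
      φ.groupSize k := by
    simp only [Expr.eval, groupSize]
    push_cast
    rfl
  have hnv := hb.numVars
  refine Runs.seq (Runs.set ?_ fun s₁ h₁ h₁' => ?_)
  · rw [hn, abs_le]
    omega
  rw [hn] at h₁
  refine Runs.seq (Runs.set (by simpa [Expr.eval] using h1) fun s₂ h₂ h₂' => ?_)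
  have h12 : ∀ x, x ≠ 2 → x ≠ 3 → s₂ x = start φ.encode x := fun x a b => by rw [h₂' x b, h₁' x a]
  refine Runs.seq (Runs.loop
    (I := fun i s' => (∀ j : ℕ, j ≤ i → s' 3 j = 2 ^ j) ∧ s' 14 0 = i ∧
      ∀ x, x ≠ 3 → x ≠ 14 → s' x = s₂ x)
    (n := φ.groupSize k) hm ⟨?_, ?_, ?_⟩ ?_ ?_)
  · intro j hj
    obtain rfl : j = 0 := by omega
    simpa [Expr.eval] using h₂
  · rw [h12 14 (by decide) (by decide), hstart 14 (by decide)]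
    rfl
  · exact fun _ _ _ => rfl
  · rintro i hi s' ⟨hp, h14, hfr⟩
    have hpi := hp i le_rfl
    refine ⟨?_, ?_⟩
    · simp only [Expr.eval, eval_reg, h14, hfr 2 (by decide) (by decide), h₂' 2 (by decide), h₁]
      omega
    refine Runs.seq (Runs.assign ?_ ?_)
    · simp only [Expr.eval, eval_reg, h14, hpi]
      rw [← pow_succ', abs_of_nonneg (by positivity)]
      have : (2 : ℤ) ^ (i + 1) ≤ 2 ^ φ.groupSize k := pow_le_pow_right₀ (by norm_num) hi
      omega
    refine Runs.set ?_ fun s'' f f' => ⟨?_, ?_, ?_⟩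
    · simp only [Expr.eval, eval_reg, Function.update_of_ne (show 14 ≠ 3 by decide), h14]
      rw [abs_le]
      omega
    · intro j hj
      rw [f' 3 (by decide)]
      simp only [Expr.eval, eval_reg, h14, hpi, Function.update_self]
      rcases hj.eq_or_lt with rfl | hj
      · push_cast
        rw [Function.update_self, pow_succ']
      · rw [Function.update_of_ne (by omega), hp j (by omega)]
    · rw [f]
      simp [Expr.eval, h14]
    · intro x h3 h14
      rw [f' x h14, Function.update_of_ne h3, hfr x h3 h14]
  · rintro s₃ ⟨hp, h14, hfr⟩
    have e2 : s₃ 2 0 = φ.groupSize k := by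
      rw [hfr 2 (by decide) (by decide), h₂' 2 (by decide), h₁]
    have h23 : ∀ x, x ≠ 2 → x ≠ 3 → x ≠ 14 → s₃ x = start φ.encode x := fun x a b c => by
      rw [hfr x b c, h12 x a b]
    refine ⟨by simp [Expr.eval, h14, e2], ?_⟩
    have e4 : (Expr.get 3 (reg 2)).eval s₃ = 2 ^ φ.groupSize k := by
      simp only [Expr.eval, eval_reg, e2, hp _ le_rfl]
    refine Runs.seq (Runs.set ?_ fun s₄ h₄ h₄' => ?_)
    · rw [e4, abs_of_nonneg (by positivity)]
      omega
    rw [e4] at h₄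
    have e5 : (Expr.mul (.const k) (reg 4)).eval s₄ = φ.numCodes k := by
      simp [Expr.eval, h₄, numCodes]
    refine Runs.seq (Runs.set ?_ fun s₅ h₅ h₅' => ?_)
    · rw [e5, abs_le]
      omega
    rw [e5] at h₅
    have e0 : s₅ 0 = ofList φ.encode := by
      rw [h₅' 0 (by decide), h₄' 0 (by decide), h23 0 (by decide) (by decide) (by decide),
        start_zero]
    have e6 : (Expr.add (.get 0 (.const 1)) (.const k)).eval s₅ = φ.numPoints k := by
      simp only [Expr.eval, e0, numPoints]
      push_cast
      rfl
    refine Runs.set ?_ fun s₆ h₆ h₆' => ?_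
    · rw [e6, abs_le]
      omega
    rw [e6] at h₆
    have h36 : ∀ x, x ≠ 4 → x ≠ 5 → x ≠ 6 → s₆ x = s₃ x := fun x a b c => by
      rw [h₆' x c, h₅' x b, h₄' x a]
    have hz : ∀ x, 7 ≤ x → x ≠ 14 → s₆ x = 0 := fun x a c => by
      rw [h36 x (by omega) (by omega) (by omega), h23 x (by omega) (by omega) c,
        hstart x (by omega)]
    refine hQ s₆ ⟨?_, ?_, ?_, ?_, ?_, ?_, h₆, ?_, ?_, ?_⟩ ?_
    · rw [h₆' 0 (by decide), e0]
    · rw [h36 1 (by decide) (by decide) (by decide), h23 1 (by decide) (by decide) (by decide),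
        hstart 1 (by decide)]
    · rw [h36 2 (by decide) (by decide) (by decide), e2]
    · rw [h36 3 (by decide) (by decide) (by decide)]
      exact hp
    · rw [h₆' 4 (by decide), h₅' 4 (by decide), h₄]
    · rw [h₆' 5 (by decide), h₅]
    · rw [hz 7 (by decide) (by decide)]
      rfl
    · rw [hz 20 (by decide) (by decide)]
      funext i
      simp [ofList]
    · exact fun x hx => hz x (by omega) (by omega)
    · rw [hz 8 (by decide) (by decide)]
      rfl

theorem encode_toCover (φ : CNF) (k : ℕ) : (φ.toCover k).encode k =
    [(k : ℤ)] ++ [(φ.numCodes k : ℤ)] ++ (List.range (φ.numCodes k)).flatMap (φ.polygonCode k) ++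
      [(φ.numPoints k : ℤ)] ++
      (List.range (φ.numPoints k)).flatMap fun i : ℕ => pointCode (2 * i - φ.numPoints k) := by
  have h : ∀ j, CoverInstance.encodePoints ((φ.abscissae k j).map onParabola) =
      φ.polygonCode k j := fun j => by
    simp only [CoverInstance.encodePoints, polygonCode, List.length_map, length_abscissae,
      List.flatMap_map, onParabola]
    push_cast
    rfl
  simp only [CoverInstance.encode, toCover, List.flatMap_map, h, List.length_map, List.length_range]
  simp [CoverInstance.encodePoints, List.flatMap_map, onParabola, pointCode]

/-- The three outer loops, over powers, codes and points, share the bound `m`. So the cost is about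
`numCodes`, that is `2 ^ (n / k)`, up to polynomial factors. -/
theorem runs_translate {m : ℕ} (hk : 0 < k) (hb : Fits φ k b)
    (hm : φ.groupSize k + φ.numCodes k + φ.numPoints k < m)
    (hQ : ∀ s', Holds φ k ((φ.toCover k).encode k) s' → Q s') :
    Runs b (m * (φ.encode.length * (φ.encode.length * 1))) (translate k) (start φ.encode) Q := by
  have h1 := hb.one_le
  have hout := hb.output
  have hD : φ.numPoints k = φ.clauses.length + k := rfl
  have hkN := φ.le_numCodes k
  refine Runs.seq (runs_setup hk hb (by omega) fun s₀ H₀ h₀ => ?_)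
  have hpos : (0 : ℤ) ≤ φ.numCodes k * (2 * φ.clauses.length + 7) := by positivity
  have hpos' : (7 : ℤ) * φ.numCodes k ≤ φ.numCodes k * (2 * φ.clauses.length + 7) := by nlinarith
  refine Runs.seq (runs_emit (v := (k : ℤ)) H₀ rfl ?_ ?_ fun s₁ H₁ h₁ => ?_)
  · rw [abs_le]
    omega
  · simp only [List.length_nil]
    omega
  refine Runs.seq (runs_emit (v := (φ.numCodes k : ℤ)) H₁ H₁.numCodes ?_ ?_ fun s₂ H₂ h₂ => ?_)
  · rw [abs_le]
    omega
  · simp only [List.nil_append, List.length_singleton]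
    omega
  have hlen : ∀ j, ((List.range j).flatMap (φ.polygonCode k)).length =
      j * (2 * φ.clauses.length + 7) := fun j => by
    simp [List.length_flatMap, length_polygonCode]
  refine Runs.seq (Runs.loop
    (I := fun j s' => Holds φ k ([(k : ℤ)] ++ [(φ.numCodes k : ℤ)] ++
      (List.range j).flatMap (φ.polygonCode k)) s' ∧ s' 8 0 = j)
    (n := φ.numCodes k) (by omega) ⟨by simpa using H₂, ?_⟩ ?_ ?_)
  · rw [h₂ 8 (by decide) (by decide), h₁ 8 (by decide) (by decide), h₀]
    rfl
  · rintro j hj s' ⟨H, e8⟩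
    refine ⟨?_, runs_polygonStep hb H e8 hj ?_ fun s'' H' e8' => ⟨?_, e8'⟩⟩
    · simp only [Expr.eval, eval_reg, H.numCodes, e8]
      omega
    · have : (j + 1 : ℤ) * (2 * φ.clauses.length + 7) ≤
          φ.numCodes k * (2 * φ.clauses.length + 7) := by
        gcongr
        exact_mod_cast hj
      simp only [List.length_append, List.length_singleton, hlen]
      push_cast
      linarith
    · simpa [List.range_succ] using H'
  · rintro s₃ ⟨H₃, h8⟩
    refine ⟨by simp [Expr.eval, H₃.numCodes, h8], ?_⟩
    refine Runs.seq (runs_emit (v := (φ.numPoints k : ℤ)) H₃ H₃.numPoints ?_ ?_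
      fun s₄ H₄ h₄ => ?_)
    · rw [abs_le]
      omega
    · simp only [List.length_append, List.length_singleton, hlen]
      push_cast
      linarith
    refine Runs.seq (Runs.set (by simp [Expr.eval]) fun s₅ h₅ h₅' => ?_)
    refine Runs.loop
      (I := fun i s' => Holds φ k ([(k : ℤ)] ++ [(φ.numCodes k : ℤ)] ++
        (List.range (φ.numCodes k)).flatMap (φ.polygonCode k) ++ [(φ.numPoints k : ℤ)] ++
        (List.range i).flatMap fun i : ℕ => pointCode (2 * i - φ.numPoints k)) s' ∧ s' 14 0 = i)
      (n := φ.numPoints k) (by omega) ⟨by simpa using H₄.congr fun x hx => h₅' x (by omega), ?_⟩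
      ?_ ?_
    · rw [h₅]
      rfl
    · rintro i hi s' ⟨H, e14⟩
      refine ⟨?_, Runs.seq (runs_emitPoint (v := 2 * i - φ.numPoints k) hb H ?_ ?_ ?_
        fun s₆ H₆ h₆ => ?_)⟩
      · simp only [Expr.eval, eval_reg, H.numPoints, e14]
        omega
      · simp [Expr.eval, H.numPoints, e14]
      · rw [abs_le]
        omega
      · rw [List.length_append, length_flatMap_pointCode]
        simp only [List.length_append, List.length_singleton, hlen, List.length_range]
        push_cast
        omega
      have e14' : s₆ 14 0 = i := by rw [h₆ 14 (by decide) (by decide) (by decide), e14]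
      refine Runs.set ?_ fun s₇ h₇ h₇' => ⟨?_, ?_⟩
      · simp only [Expr.eval, eval_reg, e14']
        rw [abs_le]
        omega
      · simpa [List.range_succ] using H₆.congr (s' := s₇) fun x hx => h₇' x (by omega)
      · rw [h₇]
        simp [Expr.eval, e14']
    · rintro s₆ ⟨H₆, e14⟩
      refine ⟨by simp [Expr.eval, H₆.numPoints, e14], hQ s₆ ?_⟩
      rwa [encode_toCover]

end

end CNF

/-! ### The reduction -/

namespace CNF

open RAM

variable (φ : CNF) (k : ℕ)

theorem length_flatMap_clauseCode {n : ℕ} (L : List (List (Fin n × Bool))) :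
    (L.flatMap clauseCode).length = (L.map fun c => c.length + 1).sum := by
  simp [List.length_flatMap, clauseCode]

theorem length_encode_add_numVars : φ.encode.length + φ.numVars = φ.size + 2 := by
  have h := congrArg List.length φ.drop_two_encode
  rw [length_flatMap_clauseCode, List.length_drop] at h
  have := φ.length_encode_pos
  unfold size
  omega

theorem numClauses_le_size : φ.clauses.length ≤ φ.size := by
  have : ∀ L : List (List (Fin φ.numVars × Bool)),
      L.length ≤ (L.map fun c => c.length + 1).sum := by
    intro L
    induction L with
    | nil => simp
    | cons c L ih =>
      simp only [List.length_cons, List.map_cons, List.sum_cons]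
      omega
  have := this φ.clauses
  unfold size
  omega

theorem abs_le_size_of_mem_encode {z : ℤ} (hz : z ∈ φ.encode) : |z| ≤ φ.size := by
  have hn : φ.numVars ≤ φ.size := Nat.le_add_right _ _
  have hM := φ.numClauses_le_size
  simp only [encode, List.mem_cons, List.mem_flatMap, List.mem_map] at hz
  rcases hz with rfl | rfl | ⟨c, hc, rfl | ⟨a, -, rfl⟩⟩
  · rw [abs_le]
    omega
  · rw [abs_le]
    omega
  · have h : c.length + 1 ≤ (φ.clauses.map fun c => c.length + 1).sum :=
      List.single_le_sum (by simp) _ (List.mem_map_of_mem (f := fun c => c.length + 1) hc)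
    have : c.length ≤ φ.size := by
      unfold size
      omega
    rw [abs_le]
    omega
  · have := a.1.2
    unfold encodeLiteral
    rw [abs_le]
    split_ifs <;> omega

/-- A bit length that suffices for the computation of the instance. -/
def bits : ℕ := 2 * (φ.groupSize k + φ.size + k + 4)

theorem fits : Fits φ k (φ.bits k) := by
  have hM := φ.numClauses_le_size
  have hL := φ.length_encode_add_numVars
  have hn : φ.numVars ≤ φ.size := Nat.le_add_right _ _
  have hD : φ.numPoints k = φ.clauses.length + k := rfl
  -- `P` is the square root of the bound: counts and abscissae stay below `P`, and products of two
  -- of them below `P * P`.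
  set P : ℕ := 2 ^ (φ.groupSize k + φ.size + k + 4) with hP
  have hb : (2 : ℤ) ^ φ.bits k = (P : ℤ) * P := by
    rw [hP, bits, two_mul, pow_add]
    push_cast
    rfl
  have hN : 16 * φ.numCodes k ≤ P := by
    have h1 : k ≤ 2 ^ k := Nat.lt_two_pow_self.le
    calc 16 * φ.numCodes k ≤ 2 ^ 4 * (2 ^ k * 2 ^ φ.groupSize k) := by
          unfold numCodes
          gcongr
          norm_num
      _ = 2 ^ (4 + (k + φ.groupSize k)) := by rw [pow_add, pow_add]
      _ ≤ P := Nat.pow_le_pow_right (by norm_num) (by omega)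
  have hS : 2 * (φ.size + k + 4) ≤ P := by
    have h1 : φ.size + k + 3 < 2 ^ (φ.size + k + 3) := Nat.lt_two_pow_self
    calc 2 * (φ.size + k + 4) ≤ 2 * 2 ^ (φ.size + k + 3) := by omega
      _ = 2 ^ (φ.size + k + 3 + 1) := (pow_succ' 2 _).symm
      _ ≤ P := Nat.pow_le_pow_right (by norm_num) (by omega)
  have hPP : (P : ℤ) * 8 ≤ P * P := by
    have : (8 : ℤ) ≤ P := by omega
    gcongr
  constructor
  · rw [hb]
    omega
  · intro z hz
    have := φ.abs_le_size_of_mem_encode hz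
    rw [hb]
    omega
  · rw [hb]
    omega
  · rw [hb, sq]
    have : ((φ.numCodes k + φ.numPoints k + 2 : ℕ) : ℤ) ≤ P := by omega
    gcongr
  · rw [hb]
    have h1 : 2 * (φ.clauses.length : ℤ) + 7 ≤ P := by omega
    have h2 : 16 * (φ.numCodes k : ℤ) ≤ P := by omega
    have h3 : 16 * (φ.numCodes k : ℤ) * (2 * (φ.clauses.length : ℤ) + 7) ≤ P * P :=
      mul_le_mul h2 h1 (by positivity) (by positivity)
    have h4 : 3 + 2 * (φ.numPoints k : ℤ) ≤ 2 * P := by omega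
    linarith

theorem bounded_start : Bounded (φ.bits k) (start φ.encode) := by
  intro x i
  unfold start
  split_ifs with h
  · rw [List.getD_eq_getElem?_getD]
    rcases hi : φ.encode[i.toNat]? with _ | z
    · simp
    · exact (φ.fits k).entry z (List.mem_of_getElem? hi)
  · simp

/-- Renaming of the arrays of a program that reads its input from array `20`. -/
def relocate (x : ℕ) : ℕ := if x = 1 then 1 else 20 + x

theorem relocate_injective : Function.Injective relocate := by
  intro x y h
  unfold relocate at h
  split_ifs at h <;> omega

/-- Decide satisfiability by a program for the covering problem. -/
theorem decidesWithin_translate {A : Prog} {T : ℝ} (hk : 0 < k)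
    (hA : DecidesWithin A ((φ.toCover k).encode k) ((φ.toCover k).HasCover k) T) :
    DecidesWithin (.seq (translate k) (A.rename relocate)) φ.encode φ.Satisfiable
      ((φ.bits k * ((φ.groupSize k + φ.numCodes k + φ.numPoints k + 1) *
        (φ.encode.length * (φ.encode.length * 1))) * (translate k).weight : ℕ) + T) := by
  obtain ⟨t, s, hex, ht, hs⟩ := hA
  obtain ⟨t₁, s₁, hex₁, ht₁, -, H⟩ := runs_translate (Q := Holds φ k ((φ.toCover k).encode k)) hk
    (φ.fits k) (Nat.lt_succ_self _) (fun _ h => h) (by unfold bits; omega)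
    (by
      have hL : 0 < φ.encode.length := two_pos.trans_le φ.length_encode_pos
      exact Nat.mul_pos (Nat.succ_pos _) (Nat.mul_pos hL (Nat.mul_pos hL one_pos))) (φ.bounded_start k)
  -- Through `relocate` the memory looks initial: array `20` holds the input, array `1` for the
  -- answer is still zero, and the arrays above `20` are untouched.
  obtain ⟨s₂, hex₂, hs₂⟩ := hex.rename relocate_injective s₁ fun x => by
    unfold relocate
    split_ifs with hx
    · subst hx
      rw [H.answer, start_succ _ one_ne_zero]
    · rcases Nat.eq_zero_or_pos x with rfl | hx0
      · rw [start_zero]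
        exact H.output
      · rw [H.unused _ (by omega), start_succ _ hx0.ne']
  refine ⟨_, s₂, .seq hex₁ hex₂, ?_, ?_⟩
  · push_cast at ht₁ ⊢
    have : (t₁ : ℝ) ≤ _ := Nat.cast_le.2 ht₁
    push_cast at this
    linarith
  · rw [← φ.hasCover_toCover k hk, ← hs, ← hs₂ 1]
    rfl

end CNF

/-- Under SETH, `k` covering polygons cannot be found faster than by trying all `k`-tuples, already
on compact instances. -/
theorem not_decides_compact_of_SETH (hSETH : SETH) {k : ℕ} (hk : 3 ≤ k) :
    ¬ ∃ (C ε : ℝ) (A : RAM.Prog), 0 < ε ∧ ∀ I : CoverInstance, 1 ≤ I.card → I.Compact →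
      RAM.DecidesWithin A (I.encode k) (I.HasCover k) (C * (I.card : ℝ) ^ ((k : ℝ) - ε)) := by
  rintro ⟨C, ε, A, hε, hA⟩
  -- A large `ε` could make the exponent negative; with `δ ≤ 1` it is at least `2`.
  set δ := min ε 1 with hδ
  have hδ0 : 0 < δ := lt_min hε one_pos
  have hδ1 : δ ≤ 1 := min_le_right _ _
  have hk3 : (3 : ℝ) ≤ k := by exact_mod_cast hk
  set x : ℝ := 2 ^ (((k : ℝ) - δ) / k) with hx
  have hx1 : 1 < x := Real.one_lt_rpow (by norm_num) (by apply div_pos <;> linarith)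
  have hx2 : x < 2 := by
    calc x < 2 ^ (1 : ℝ) := by
          apply Real.rpow_lt_rpow_of_exponent_lt (by norm_num)
          rw [div_lt_one (by linarith)]
          linarith
      _ = 2 := Real.rpow_one 2
  refine hSETH (2 - x) (by linarith) (by linarith)
    -- The constant adds those of `hred` and `hcov`. The exponent `k + 4` covers both the `S ^ 4` of
    -- the translation and the `S ^ k` of the covering algorithm.
    ⟨.seq (CNF.translate k) (A.rename CNF.relocate),
    ((2 * k + 12) * (3 * k + 3) * 4 * (CNF.translate k).weight + |C| * (3 * k + 1) ^ k : ℝ),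
    k + 4, fun φ => ?_⟩
  have hcard : 1 ≤ (φ.toCover k).card := by
    have := φ.le_numCodes k
    rw [φ.card_toCover]
    omega
  obtain ⟨t, s, hex, ht, hs⟩ := φ.decidesWithin_translate k (by omega)
    (hA _ hcard (φ.compact_toCover k hk))
  refine ⟨t, s, hex, ht.trans ?_, hs⟩
  rw [sub_sub_cancel]
  set S : ℝ := (φ.size : ℝ) + 1 with hS
  set E : ℝ := 2 ^ (φ.numVars / k) with hE
  have hS1 : 1 ≤ S := by simp [hS]
  have hE1 : 1 ≤ E := one_le_pow₀ (by norm_num)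
  have hES : S ≤ E * S := by nlinarith
  have hES' : E ≤ E * S := by nlinarith
  have hN : (φ.numCodes k : ℝ) = 2 * k * E := by
    unfold CNF.numCodes CNF.groupSize
    push_cast
    rw [pow_succ]
    ring
  have hM : (φ.clauses.length : ℝ) + 1 ≤ S := by
    have := φ.numClauses_le_size
    simp only [hS]
    gcongr
  have hD : (φ.numPoints k : ℝ) = φ.clauses.length + k := by simp [CNF.numPoints]
  have hg : (φ.groupSize k : ℝ) ≤ S := by
    have h1 : φ.groupSize k ≤ φ.size + 1 := by
      have h2 : φ.numVars ≤ φ.size := Nat.le_add_right _ _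
      exact Nat.succ_le_succ ((Nat.div_le_self _ _).trans h2)
    rw [hS]
    exact_mod_cast h1
  have hL : (φ.encode.length : ℝ) ≤ 2 * S := by
    have h1 : φ.encode.length ≤ 2 * (φ.size + 1) := by
      have := φ.length_encode_add_numVars
      omega
    rw [hS]
    exact_mod_cast h1
  have hkES : (k : ℝ) ≤ k * (E * S) := le_mul_of_one_le_right (by positivity) (by linarith)
  have hkE : (k : ℝ) * E ≤ k * (E * S) := by gcongr
  have hbits : (φ.bits k : ℝ) ≤ (2 * k + 12) * S := by
    unfold CNF.bits
    push_cast
    nlinarith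
  have hm : (φ.groupSize k : ℝ) + φ.numCodes k + φ.numPoints k + 1 ≤ (3 * k + 3) * (E * S) := by
    rw [hN, hD]
    linarith
  have hc : ((φ.toCover k).card : ℝ) ≤ (3 * k + 1) * (E * S) := by
    rw [φ.card_toCover]
    push_cast
    rw [hN, hD]
    linarith
  have hEx : E ^ ((k : ℝ) - δ) ≤ x ^ φ.numVars := by
    have h1 : ((φ.numVars / k : ℕ) : ℝ) ≤ φ.numVars / k := Nat.cast_div_le
    rw [hE, hx, ← Real.rpow_natCast, ← Real.rpow_natCast, ← Real.rpow_mul (by norm_num),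
      ← Real.rpow_mul (by norm_num)]
    apply Real.rpow_le_rpow_of_exponent_le (by norm_num)
    calc ((φ.numVars / k : ℕ) : ℝ) * (k - δ) ≤ φ.numVars / k * (k - δ) := by
          apply mul_le_mul_of_nonneg_right h1
          linarith
      _ = (k - δ) / k * φ.numVars := by ring
  -- The translation costs only the first power of `E`, which `k - δ ≥ 1` makes affordable.
  have hEx' : E ≤ x ^ φ.numVars := by
    refine le_trans ?_ hEx
    calc E = E ^ (1 : ℝ) := (Real.rpow_one E).symm
      _ ≤ E ^ ((k : ℝ) - δ) := Real.rpow_le_rpow_of_exponent_le hE1 (by linarith)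
  have hred : ((φ.bits k * ((φ.groupSize k + φ.numCodes k + φ.numPoints k + 1) *
      (φ.encode.length * (φ.encode.length * 1))) * (CNF.translate k).weight : ℕ) : ℝ) ≤
      (2 * k + 12) * (3 * k + 3) * 4 * (CNF.translate k).weight * x ^ φ.numVars * S ^ (k + 4) := by
    push_cast
    calc (φ.bits k : ℝ) * ((φ.groupSize k + φ.numCodes k + φ.numPoints k + 1) *
          (φ.encode.length * (φ.encode.length * 1))) * (CNF.translate k).weight
        ≤ (2 * k + 12) * S * ((3 * k + 3) * (x ^ φ.numVars * S) * (2 * S * (2 * S * 1))) *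
          (CNF.translate k).weight := by
          gcongr
          exact hm.trans (by gcongr)
      _ = (2 * k + 12) * (3 * k + 3) * 4 * (CNF.translate k).weight * x ^ φ.numVars * S ^ 4 := by
          ring
      _ ≤ _ := by
          gcongr
          omega
  have hcov : C * ((φ.toCover k).card : ℝ) ^ ((k : ℝ) - ε) ≤
      |C| * (3 * k + 1) ^ k * x ^ φ.numVars * S ^ (k + 4) := by
    have hc1 : (1 : ℝ) ≤ (φ.toCover k).card := by exact_mod_cast hcard
    have hpow : ∀ y : ℝ, 1 ≤ y → y ^ ((k : ℝ) - δ) ≤ y ^ k := fun y hy => by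
      rw [← Real.rpow_natCast]
      exact Real.rpow_le_rpow_of_exponent_le hy (by linarith)
    calc C * ((φ.toCover k).card : ℝ) ^ ((k : ℝ) - ε)
        ≤ |C| * ((φ.toCover k).card : ℝ) ^ ((k : ℝ) - δ) := by
          refine mul_le_mul (le_abs_self C) ?_ (by positivity) (abs_nonneg C)
          exact Real.rpow_le_rpow_of_exponent_le hc1 (by linarith [min_le_left ε 1])
      _ ≤ |C| * ((3 * k + 1) * (E * S)) ^ ((k : ℝ) - δ) := by
          gcongr
          linarith
      _ = |C| * ((3 * k + 1 : ℝ) ^ ((k : ℝ) - δ) * (E ^ ((k : ℝ) - δ) * S ^ ((k : ℝ) - δ))) := by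
          rw [Real.mul_rpow (by positivity) (by positivity),
            Real.mul_rpow (by positivity) (by positivity)]
      _ ≤ |C| * ((3 * k + 1 : ℝ) ^ k * (x ^ φ.numVars * S ^ k)) := by
          gcongr
          · exact hpow _ (by linarith)
          · exact hpow _ hS1
      _ ≤ |C| * ((3 * k + 1 : ℝ) ^ k * (x ^ φ.numVars * S ^ (k + 4))) := by
          gcongr
          omega
      _ = _ := by ring
  calc _ ≤ _ := add_le_add hred hcov
    _ = _ := by ring

theorem mainTheorem11 (hSETH : SETH) :
    (¬ ∃ (f : ℕ → ℕ) (ε : ℝ) (A : RAM.Prog), Computable f ∧ 0 < ε ∧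
      ∀ (k : ℕ) (I : CoverInstance), 1 ≤ k → 1 ≤ I.card →
        RAM.DecidesWithin A (I.encode k) (I.HasCover k)
          ((f k : ℝ) * (I.card : ℝ) ^ ((k : ℝ) - ε))) ∧
    (∀ k : ℕ, 3 ≤ k → ¬ ∃ (C ε : ℝ) (A : RAM.Prog), 0 < ε ∧
      ∀ I : CoverInstance, 1 ≤ I.card → I.Compact →
        RAM.DecidesWithin A (I.encode k) (I.HasCover k)
          (C * (I.card : ℝ) ^ ((k : ℝ) - ε))) := by
  refine ⟨?_, fun k hk => not_decides_compact_of_SETH hSETH hk⟩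
  rintro ⟨f, ε, A, -, hε, hA⟩
  -- For the single value `k = 3` the factor `f 3` is a constant.
  exact not_decides_compact_of_SETH hSETH le_rfl
    ⟨f 3, ε, A, hε, fun I hI _ => hA 3 I (by norm_num) hI⟩
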